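/- Let $\rho,r\ge 0$ with $\frac{\rho}{2}+r\ge 1$, let $s>\frac12$, and let $L$, $B$ be the Fourier multiplier operators on $\mathbb R$ with measurable real symbols $l$, $b$, i.e. $\mathcal F(Lw)=l\,\mathcal F w$, $\mathcal F(Bw)=b\,\mathcal F w$ (symbols are written in the frequency variable $\xi$ for which $-\partial_x^2$ has symbol $\xi^2$). Assume that for some constants $c_1,c_2,c_3>0$ and all $\xi\in\mathbb R$ $$c_1^2(1+\xi^2)^{\rho/2}\le l(\xi)\le c_2^2(1+\xi^2)^{\rho/2},\qquad 0<b(\xi)\le c_3^2(1+\xi^2)^{-r/2}.$$ Let $g\in C^{[s]+1}(\mathbb R)$ be real-valued with $g(0)=0$, and put $G(y)=\int_0^y g(p)\,dp$, $K=L^{1/2}$ (symbol $l^{1/2}$), $\Lambda^{-1}w=\mathcal F^{-1}[|\xi|^{-1}\mathcal F w]$ and $B^{-1/2}w=\mathcal F^{-1}[b(\xi)^{-1/2}\mathcal F w]$. Let $0<T<\infty$, $\varphi\in H^s(\mathbb R)$, $\psi\in H^{s-1-\rho/2}(\mathbb R)$, and let the real-valued function $$u\in C([0,T),H^s)\cap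 C^1([0,T),H^{s-1-\rho/2})$$ be a solution (in the sense of distributions) of the Cauchy problem $$u_{tt}-Lu_{xx}=B(g(u))_{xx},\quad x\in\mathbb R,\ 0<t<T,\qquad u(x,0)=\varphi(x),\quad u_t(x,0)=\psi(x).$$ If $B^{-1/2}\Lambda^{-1}\psi\in L^2$, $B^{-1/2}K\varphi\in L^2$ and $G(\varphi)\in L^1$, then for every $t\in[0,T)$ one has $B^{-1/2}\Lambda^{-1}u_t(t)\in L^2$, $B^{-1/2}Ku(t)\in L^2$, $G(u(t))\in L^1$, and the energy identity $$E(t)=\|B^{-1/2}\Lambda^{-1}u_t(t)\|^2+\|B^{-1/2}Ku(t)\|^2+2\int_{\mathbb R}G(u(x,t))\,dx=E(0)$$ holds, where $\|\cdot\|$ is the norm of $L^2(\mathbb R)$ and $E(0)=\|B^{-1/2}\Lambda^{-1}\psi\|^2+\|B^{-1/2}K\varphi\|^2+2\int_{\mathbb R}G(\varphi)\,dx$. -/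

import Mathlib

open MeasureTheory Set
open scoped SchwartzMap FourierTransform LineDeriv ENNReal

noncomputable section

namespace DoubleDispersive

/-- The complex Hilbert space `L²(ℝ)`. Its elements are regarded as tempered distributions
through Mathlib's coercion. -/
abbrev L2 : Type := Lp ℂ 2 (volume : Measure ℝ)

/-- The tempered distribution `f` is the regular distribution given by the function `F`. -/
def HasDensity (f : 𝓢'(ℝ, ℂ)) (F : ℝ → ℂ) : Prop :=
  ∀ θ : 𝓢(ℝ, ℂ), Integrable (fun x => θ x * F x) ∧ f θ = ∫ x, θ x * F x

/-- `IsFourierMultiplier m f h` says that `𝓕 f` is a function and that `h = 𝓕⁻¹ (m(ξ) 𝓕 f)`,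
i.e. `f` is in the domain of the operator with symbol `m` and `h` is its image.
(The density `F` of `𝓕 f` is unique up to null sets, so `h` is determined by `m` and `f`, and the
value of `m` at the single point `0` is immaterial.)
Symbols are functions of the angular frequency `ξ`, for which `-∂ₓ²` has symbol `ξ²`. Mathlib's
Fourier transform has kernel `exp (-2πixη)`, hence `ξ = 2πη`; it is unitary on `L²`. -/
def IsFourierMultiplier (m : ℝ → ℝ) (f h : 𝓢'(ℝ, ℂ)) : Prop :=
  ∃ F : ℝ → ℂ, HasDensity (𝓕 f) F ∧
    HasDensity (𝓕 h) (fun η => (m (2 * Real.pi * η) : ℂ) * F η)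

/-- The tempered distribution of a real function in `L²(ℝ)` (zero if the function is not
in `L²`). -/
def ofL2 (f : ℝ → ℝ) : 𝓢'(ℝ, ℂ) :=
  open Classical in
  if hf : MemLp (fun x => (f x : ℂ)) 2 volume then ((hf.toLp _ : L2) : 𝓢'(ℝ, ℂ)) else 0

/-- `f ∈ C(I, H^σ)`. The Bessel potential of order `σ` (Fourier multiplier with
`(1 + η²)^(σ/2)`) identifies `H^σ(ℝ)` with `L²(ℝ)`, up to equivalence of norms. -/
def SobolevContinuousOn (σ : ℝ) (I : Set ℝ) (f : ℝ → 𝓢'(ℝ, ℂ)) : Prop :=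
  ∃ w : ℝ → L2,
    (∀ t ∈ I, TemperedDistribution.besselPotential ℝ ℂ σ (f t) = (w t : 𝓢'(ℝ, ℂ))) ∧
    ContinuousOn w I

/-- `f ∈ C¹(I, H^σ)` with derivative `f'` (one-sided at an endpoint belonging to `I`). -/
def SobolevC1On (σ : ℝ) (I : Set ℝ) (f f' : ℝ → 𝓢'(ℝ, ℂ)) : Prop :=
  ∃ w w' : ℝ → L2,
    (∀ t ∈ I, TemperedDistribution.besselPotential ℝ ℂ σ (f t) = (w t : 𝓢'(ℝ, ℂ))) ∧
    (∀ t ∈ I, TemperedDistribution.besselPotential ℝ ℂ σ (f' t) = (w' t : 𝓢'(ℝ, ℂ))) ∧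
    (∀ t ∈ I, HasDerivWithinAt w (w' t) I t) ∧
    ContinuousOn w' I

/-- The second distributional `x`-derivative. -/
def dxx (f : 𝓢'(ℝ, ℂ)) : 𝓢'(ℝ, ℂ) := ∂_{(1 : ℝ)} (∂_{(1 : ℝ)} f)

/-- `u` (with time derivative `v = u_t`) is a solution on `[0, T)` of the Cauchy problem
`u_tt - L u_xx = B (g(u))_xx`, `u(0) = φ`, `u_t(0) = ψ`, where `L`, `B` have symbols `l`, `b`, in
the class `C([0,T), H^s) ∩ C¹([0,T), H^(s - 1 - ρ/2))`. Here `u t x` is the value of `u` at time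
`t` and position `x`; the function `u t` is real and matters only up to null sets; the equation
holds in the sense of tempered distributions in `x`, for every `t ∈ (0, T)`. -/
structure IsSolution (ρ s : ℝ) (l b g : ℝ → ℝ) (T : ℝ) (φ : ℝ → ℝ) (ψ : 𝓢'(ℝ, ℂ))
    (u : ℝ → ℝ → ℝ) (v : ℝ → 𝓢'(ℝ, ℂ)) : Prop where
  memLp : ∀ t ∈ Ico 0 T, MemLp (fun x => (u t x : ℂ)) 2 volume
  continuousOn : SobolevContinuousOn s (Ico 0 T) (fun t => ofL2 (u t))
  c1On : SobolevC1On (s - 1 - ρ / 2) (Ico 0 T) (fun t => ofL2 (u t)) v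
  equation : ∀ t ∈ Ioo 0 T, ∃ Luxx Bgxx : 𝓢'(ℝ, ℂ),
    IsFourierMultiplier l (dxx (ofL2 (u t))) Luxx ∧
    IsFourierMultiplier b (dxx (ofL2 (fun x => g (u t x)))) Bgxx ∧
    ∀ θ : 𝓢(ℝ, ℂ), HasDerivAt (fun τ => v τ θ) (Luxx θ + Bgxx θ) t
  initial : u 0 =ᵐ[volume] φ
  initial_deriv : v 0 = ψ

/-- The symbol `b(ξ)^(-1/2) |ξ|⁻¹` of `B^(-1/2) Λ⁻¹`. -/
def symbolBΛ (b : ℝ → ℝ) (ξ : ℝ) : ℝ := b ξ ^ (-(1 / 2) : ℝ) * |ξ|⁻¹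

/-- The symbol `b(ξ)^(-1/2) l(ξ)^(1/2)` of `B^(-1/2) K`, where `K = L^(1/2)`. -/
def symbolBK (b l : ℝ → ℝ) (ξ : ℝ) : ℝ := b ξ ^ (-(1 / 2) : ℝ) * Real.sqrt (l ξ)

/-- The primitive `G(y) = ∫₀^y g(p) dp`. -/
def primitive (g : ℝ → ℝ) (y : ℝ) : ℝ := ∫ p in (0 : ℝ)..y, g p

end DoubleDispersive

end

/-!
On the Fourier side the equation is an oscillator for every frequency: with `X = |ξ|`, `k² = l`,
`m² = b`, the transform `U` of `u` satisfies `U'' = -X²k² U - X²m² N(U)`, where `N` is the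
transform of `u ↦ g(u)`, and the energy is `‖U'/(X m)‖² + ‖(k/m) U‖² + 2 ∫ G(u)`. The formal proof
multiplies the equation by `U'/(X² m²)`. Three things have to be justified: that `G(u(t))` makes
sense, that the energy stays finite, and that no energy is lost in the limit of large and small
frequencies.

*The nonlinearity.* By `H^s ⊂ L^∞` and continuity in time, `u` is bounded on `[0, t₁] × ℝ`, so `g`
may be replaced there by a globally Lipschitz function `γ` with `γ 0 = 0`
(`SobolevContinuousOn.exists_bound`, `exists_lipschitz_extension`). Its superposition operator is
Lipschitz on `L²` and is the gradient of the potential energy (`hasFDerivAt_potential`). The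
derivative `U''` is only given through the pairing with test functions; as the right-hand side is
continuous in a weighted `L²` space, it also exists in norm (`hasDerivAt_of_pairing`).

*Finiteness.* The forcing in the energy balance has size `X m N(U)`, and `X m` may grow like
`|ξ|^σ` with `σ = 1 - min(r, 1)/2 ≤ 1`, so `γ(u)` has to have `σ` derivatives in `L²`, uniformly in
time; the regularity `s` of `u` may be less than `σ`, and these derivatives come from the energy.
A Lipschitz superposition is bounded on `H^σ` because it contracts the difference seminorms
`‖f(· + h) - f‖` up to the Lipschitz constant, and these seminorms propagate in time: since
`ρ/2 + r ≥ 1` makes `X m²/k` bounded, Gronwall's inequality bounds the seminorm with step `h` of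
`U(t)` by that of the data, uniformly in `h` (`exists_diffSymbol_bound`). Integrating over `h`, or
letting `h → 0` if `σ = 1`, yields the derivatives of order `σ` (`lintegral_rpow_mul_le`). The data
have them since `|ξ|^σ m/k` is bounded and the initial energy is finite. Hence `X m N(U)` is bounded
in `L²`, for the solution and for its truncations in frequency (`exists_nonlinear_bound`), and a
second use of Gronwall's inequality bounds the energy (`exists_energy_bound`).

*Conservation.* Truncate in frequency to sets `S n` on which all symbols are bounded above and
below. The derivative of the truncated total energy is then the inner product of the kinetic
amplitude with `X m (N(U_n) - N(U))`, where `U_n` is the truncation of `U`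
(`hasDerivAt_total_energy`). The second factor is bounded in `L²`, and `N(U_n) → N(U)` in `L²`, so it
tends to zero weakly, and the inner product tends to zero (`tendsto_inner_truncated`). By dominated
convergence in time the energy is conserved (`Evolution.energy_eq`).
-/

noncomputable section

namespace DoubleDispersive

open Filter Topology
open scoped InnerProductSpace NNReal

/-! ### Bounded multiplication operators on `L²` -/

/-- A bounded measurable real function. -/
def BddMeas (a : ℝ → ℝ) : Prop := Measurable a ∧ ∃ C, ∀ x, |a x| ≤ C

theorem BddMeas.memLp {a : ℝ → ℝ} (ha : BddMeas a) (f : L2) :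
    MemLp (fun x => (a x : ℂ) * f x) 2 volume := by
  obtain ⟨hm, C, hC⟩ := ha
  refine MemLp.of_le_mul (c := C) (Lp.memLp f)
    ((Complex.measurable_ofReal.comp hm).aestronglyMeasurable.mul (Lp.aestronglyMeasurable f)) ?_
  refine ae_of_all _ fun x => ?_
  rw [norm_mul, Complex.norm_real]
  gcongr
  exact hC x

theorem BddMeas.mul {a b : ℝ → ℝ} (ha : BddMeas a) (hb : BddMeas b) :
    BddMeas (fun x => a x * b x) := by
  obtain ⟨hm, C, hC⟩ := ha
  obtain ⟨hm', C', hC'⟩ := hb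
  refine ⟨hm.mul hm', C * C', fun x => ?_⟩
  rw [abs_mul]
  exact mul_le_mul (hC x) (hC' x) (abs_nonneg _) ((abs_nonneg _).trans (hC x))

theorem BddMeas.indicator {a : ℝ → ℝ} (ha : BddMeas a) {S : Set ℝ} (hS : MeasurableSet S) :
    BddMeas (S.indicator a) := by
  obtain ⟨hm, C, hC⟩ := ha
  refine ⟨hm.indicator hS, C, fun x => ?_⟩
  by_cases hx : x ∈ S
  · simpa [hx] using hC x
  · simpa [hx] using (abs_nonneg _).trans (hC x)

theorem bddMeas_const (c : ℝ) : BddMeas (fun _ => c) :=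
  ⟨measurable_const, |c|, fun _ => le_rfl⟩

open Classical in
/-- Multiplication by the bounded measurable real function `a`, as a real-linear operator on `L²`
(zero if `a` is not bounded and measurable). -/
def mulOp (a : ℝ → ℝ) : L2 →L[ℝ] L2 :=
  if ha : BddMeas a then
    LinearMap.mkContinuousOfExistsBound
      { toFun := fun f => (ha.memLp f).toLp _
        map_add' := fun f g => by
          rw [← MemLp.toLp_add]
          apply MemLp.toLp_congr
          filter_upwards [Lp.coeFn_add f g] with x hx
          rw [hx, Pi.add_apply, mul_add]; rfl
        map_smul' := fun c f => by
          rw [RingHom.id_apply, ← MemLp.toLp_const_smul]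
          apply MemLp.toLp_congr
          filter_upwards [Lp.coeFn_smul c f] with x hx
          simp only [hx, Pi.smul_apply, Complex.real_smul]
          ring }
      (by
        obtain ⟨C, hC⟩ := ha.2
        refine ⟨C, fun f => Lp.norm_le_mul_norm_of_ae_le_mul ?_⟩
        filter_upwards [(ha.memLp f).coeFn_toLp] with x hx
        change ‖((ha.memLp f).toLp _ : L2) x‖ ≤ _
        rw [hx, norm_mul, Complex.norm_real]
        gcongr
        exact hC x)
  else 0

theorem mulOp_coe {a : ℝ → ℝ} (ha : BddMeas a) (f : L2) :
    mulOp a f =ᵐ[volume] fun x => (a x : ℂ) * f x := by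
  unfold mulOp
  rw [dif_pos ha]
  exact (ha.memLp f).coeFn_toLp

theorem eq_mulOp_iff {a : ℝ → ℝ} (ha : BddMeas a) (f g : L2) :
    g = mulOp a f ↔ g =ᵐ[volume] fun x => (a x : ℂ) * f x :=
  ⟨fun h => h ▸ mulOp_coe ha f, fun h => Lp.ext (h.trans (mulOp_coe ha f).symm)⟩

theorem mulOp_mulOp {a b : ℝ → ℝ} (ha : BddMeas a) (hb : BddMeas b) (f : L2) :
    mulOp a (mulOp b f) = mulOp (fun x => a x * b x) f := by
  rw [eq_mulOp_iff (ha.mul hb)]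
  filter_upwards [mulOp_coe ha (mulOp b f), mulOp_coe hb f] with x h1 h2
  rw [h1, h2]; push_cast; ring

theorem mulOp_congr {a b : ℝ → ℝ} (ha : BddMeas a) (hb : BddMeas b) {f g : L2}
    (h : ∀ᵐ x, (a x : ℂ) * f x = b x * g x) : mulOp a f = mulOp b g := by
  rw [eq_mulOp_iff hb]
  filter_upwards [mulOp_coe ha f, h] with x h1 h2
  rw [h1, h2]

theorem inner_eq_integral (f g : L2) : ⟪f, g⟫_ℝ = ∫ x, ⟪f x, g x⟫_ℝ := L2.inner_def f g

theorem inner_mulOp_left {a : ℝ → ℝ} (ha : BddMeas a) (f g : L2) :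
    ⟪mulOp a f, g⟫_ℝ = ⟪f, mulOp a g⟫_ℝ := by
  rw [inner_eq_integral, inner_eq_integral]
  apply integral_congr_ae
  filter_upwards [mulOp_coe ha f, mulOp_coe ha g] with x h1 h2
  rw [h1, h2, ← Complex.real_smul, ← Complex.real_smul, real_inner_smul_left,
    real_inner_smul_right]

theorem norm_mulOp_le {a b : ℝ → ℝ} (ha : BddMeas a) (hb : BddMeas b) {C : ℝ}
    (h : ∀ᵐ x, |a x| ≤ C * |b x|) (f : L2) : ‖mulOp a f‖ ≤ C * ‖mulOp b f‖ := by
  apply Lp.norm_le_mul_norm_of_ae_le_mul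
  filter_upwards [mulOp_coe ha f, mulOp_coe hb f, h] with x h1 h2 h3
  rw [h1, h2, norm_mul, norm_mul, Complex.norm_real, Complex.norm_real, ← mul_assoc]
  gcongr
  exact h3

theorem norm_mulOp_le_mul {a : ℝ → ℝ} (ha : BddMeas a) {C : ℝ}
    (h : ∀ᵐ x, |a x| ≤ C) (f : L2) : ‖mulOp a f‖ ≤ C * ‖f‖ := by
  apply Lp.norm_le_mul_norm_of_ae_le_mul
  filter_upwards [mulOp_coe ha f, h] with x h1 h3
  rw [h1, norm_mul, Complex.norm_real]
  gcongr
  exact h3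

theorem ofReal_norm_sq (f : L2) : ENNReal.ofReal (‖f‖ ^ 2) = ∫⁻ x, ‖f x‖ₑ ^ 2 := by
  rw [Lp.norm_def, ENNReal.ofReal_pow ENNReal.toReal_nonneg,
    ENNReal.ofReal_toReal (Lp.eLpNorm_ne_top f),
    eLpNorm_eq_lintegral_rpow_enorm_toReal (by norm_num) (by norm_num)]
  rw [← ENNReal.rpow_natCast, ← ENNReal.rpow_mul]
  simp

theorem ofReal_norm_mulOp_sq {a : ℝ → ℝ} (ha : BddMeas a) (f : L2) :
    ENNReal.ofReal (‖mulOp a f‖ ^ 2) = ∫⁻ x, ENNReal.ofReal (a x ^ 2) * ‖f x‖ₑ ^ 2 := by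
  rw [ofReal_norm_sq]
  apply lintegral_congr_ae
  filter_upwards [mulOp_coe ha f] with x h1
  rw [h1, enorm_mul, mul_pow, ← ofReal_norm, Complex.norm_real,
    ← ENNReal.ofReal_pow (norm_nonneg _), Real.norm_eq_abs, sq_abs]

theorem memLp_two_of_lintegral {F : ℝ → ℂ} (hF : AEStronglyMeasurable F volume)
    (h : ∫⁻ x, ‖F x‖ₑ ^ 2 < ∞) : MemLp F 2 volume := by
  refine ⟨hF, ?_⟩
  rw [eLpNorm_lt_top_iff_lintegral_rpow_enorm_lt_top (by norm_num) (by norm_num)]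
  simpa using h

/-! ### Exhausting sets -/

/-- The sets `S n` are measurable, increasing, and exhaust the line up to a null set. -/
structure Exhaustion (S : ℕ → Set ℝ) : Prop where
  meas : ∀ n, MeasurableSet (S n)
  mono : Monotone S
  ae_mem : ∀ᵐ x, ∃ n, x ∈ S n

/-- The multiplication operator by the characteristic function of `S`. -/
def cutoff (S : Set ℝ) : L2 →L[ℝ] L2 := mulOp (S.indicator fun _ => 1)

theorem bddMeas_indicator_one {S : Set ℝ} (hS : MeasurableSet S) :
    BddMeas (S.indicator fun _ => 1) := (bddMeas_const 1).indicator hS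

theorem cutoff_coe {S : Set ℝ} (hS : MeasurableSet S) (f : L2) :
    cutoff S f =ᵐ[volume] S.indicator f := by
  filter_upwards [mulOp_coe (bddMeas_indicator_one hS) f] with x hx
  unfold cutoff
  rw [hx]
  by_cases h : x ∈ S <;> simp [h]

theorem norm_cutoff_le {S : Set ℝ} (hS : MeasurableSet S) (f : L2) : ‖cutoff S f‖ ≤ ‖f‖ := by
  have := norm_mulOp_le_mul (bddMeas_indicator_one hS) (C := 1) (ae_of_all _ fun x => ?_) f
  · simpa [cutoff] using this
  · by_cases h : x ∈ S <;> simp [h]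

theorem Exhaustion.ae_eventually {S : ℕ → Set ℝ} (hS : Exhaustion S) :
    ∀ᵐ x, ∀ᶠ n in atTop, x ∈ S n := by
  filter_upwards [hS.ae_mem] with x ⟨n, hn⟩
  filter_upwards [eventually_ge_atTop n] with m hm
  exact hS.mono hm hn

theorem Exhaustion.tendsto_cutoff {S : ℕ → Set ℝ} (hS : Exhaustion S) (f : L2) :
    Tendsto (fun n => cutoff (S n) f) atTop (𝓝 f) := by
  rw [tendsto_iff_norm_sub_tendsto_zero]
  have key : Tendsto (fun n => ENNReal.ofReal (‖cutoff (S n) f - f‖ ^ 2)) atTop (𝓝 0) := by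
    simp_rw [ofReal_norm_sq]
    have hle : ∀ n, ∀ᵐ x, ‖(cutoff (S n) f - f : L2) x‖ₑ ^ 2 ≤ ‖f x‖ₑ ^ 2 := by
      intro n
      filter_upwards [Lp.coeFn_sub (cutoff (S n) f) f, cutoff_coe (hS.meas n) f] with x h1 h2
      rw [h1, Pi.sub_apply, h2]
      by_cases h : x ∈ S n <;> simp [h]
    have := tendsto_lintegral_of_dominated_convergence' (f := fun _ => 0)
      (F := fun n x => ‖(cutoff (S n) f - f : L2) x‖ₑ ^ 2) (μ := volume) (fun x => ‖f x‖ₑ ^ 2)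
      (fun n => ((Lp.aestronglyMeasurable _).enorm.pow_const 2)) hle
      (by rw [← ofReal_norm_sq]; exact ENNReal.ofReal_ne_top) ?_
    · simpa using this
    have h2 : ∀ᵐ x, ∀ n, (cutoff (S n) f - f : L2) x = (S n).indicator f x - f x := by
      rw [ae_all_iff]
      intro n
      filter_upwards [Lp.coeFn_sub (cutoff (S n) f) f, cutoff_coe (hS.meas n) f] with x h1 h2
      rw [h1, Pi.sub_apply, h2]
    filter_upwards [h2, hS.ae_eventually] with x hx hev
    apply tendsto_const_nhds.congr'
    filter_upwards [hev] with n hn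
    rw [hx n, indicator_of_mem hn]; simp
  have := (ENNReal.tendsto_toReal (by simp)).comp key
  simp only [Function.comp_def, ENNReal.toReal_zero] at this
  have h3 := this.sqrt
  rw [Real.sqrt_zero] at h3
  refine h3.congr fun n => ?_
  rw [ENNReal.toReal_ofReal (by positivity), Real.sqrt_sq (norm_nonneg _)]

/-- A function whose truncations to the sets of an exhaustion are bounded in `L²` belongs to `L²`. -/
theorem Exhaustion.memLp {S : ℕ → Set ℝ} (hS : Exhaustion S) {F : ℝ → ℂ}
    (hF : AEStronglyMeasurable F volume) {f : ℕ → L2} {B : ℝ}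
    (hf : ∀ n, f n =ᵐ[volume] (S n).indicator F) (hB : ∀ n, ‖f n‖ ^ 2 ≤ B) :
    MemLp F 2 volume := by
  apply memLp_two_of_lintegral hF
  have h1 : ∫⁻ x, ‖F x‖ₑ ^ 2 ≤ ∫⁻ x, liminf (fun n => ‖f n x‖ₑ ^ 2) atTop := by
    apply lintegral_mono_ae
    filter_upwards [ae_all_iff.2 hf, hS.ae_eventually] with x hx hev
    apply le_of_eq
    symm
    apply Tendsto.liminf_eq
    apply tendsto_const_nhds.congr'
    filter_upwards [hev] with n hn
    rw [hx n, indicator_of_mem hn]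
  refine (h1.trans (lintegral_liminf_le' fun n => ?_)).trans_lt ?_
  · exact (Lp.aestronglyMeasurable _).enorm.pow_const 2
  refine lt_of_le_of_lt ?_ (ENNReal.ofReal_lt_top (r := B))
  apply liminf_le_of_le
  · isBoundedDefault
  intro b hb
  obtain ⟨n, hn⟩ := hb.exists
  refine hn.trans ?_
  rw [← ofReal_norm_sq]
  exact ENNReal.ofReal_le_ofReal (hB n)

/-! ### Translations and fractional regularity -/

/-- The modulus `|exp(2πihη) - 1| = 2|sin(πhη)|` of the symbol of the difference operator
`f ↦ f(· + h) - f`. -/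
def diffSymbol (h η : ℝ) : ℝ := 2 * |Real.sin (Real.pi * h * η)|

theorem diffSymbol_nonneg (h η : ℝ) : 0 ≤ diffSymbol h η := by unfold diffSymbol; positivity

theorem bddMeas_diffSymbol (h : ℝ) : BddMeas (diffSymbol h) := by
  refine ⟨by unfold diffSymbol; fun_prop, 2, fun η => ?_⟩
  rw [abs_of_nonneg (diffSymbol_nonneg h η), diffSymbol]
  have := Real.abs_sin_le_one (Real.pi * h * η)
  linarith

theorem norm_phase_sub_one (h η : ℝ) :
    ‖(Real.fourierChar (h * η) : ℂ) - 1‖ = diffSymbol h η := by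
  rw [Real.fourierChar_apply, diffSymbol]
  have := Complex.norm_exp_I_mul_ofReal_sub_one (2 * Real.pi * (h * η))
  rw [mul_comm Complex.I] at this
  rw [this, norm_mul, Real.norm_eq_abs, Real.norm_eq_abs, abs_of_pos (by norm_num : (0:ℝ) < 2)]
  congr 3
  ring

/-- The translation `f ↦ f(· + h)` of `L²`. -/
def translate (h : ℝ) (f : L2) : L2 :=
  Lp.compMeasurePreserving (· + h) (measurePreserving_add_right volume h) f

theorem translate_coe (h : ℝ) (f : L2) : translate h f =ᵐ[volume] fun x => f (x + h) :=
  Lp.coeFn_compMeasurePreserving f (measurePreserving_add_right volume h)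

theorem continuous_translate (h : ℝ) : Continuous (translate h) :=
  (Lp.isometry_compMeasurePreserving (E := ℂ) (p := 2)
    (measurePreserving_add_right (volume : Measure ℝ) h)).continuous

theorem fourier_translate_schwartz (h : ℝ) (f : 𝓢(ℝ, ℂ)) (η : ℝ) :
    𝓕 (f.compSubConstCLM ℂ (-h)) η = (Real.fourierChar (h * η) : ℂ) * 𝓕 f η := by
  rw [SchwartzMap.fourier_coe, SchwartzMap.fourier_coe]
  have h1 : ((f.compSubConstCLM ℂ (-h) : 𝓢(ℝ, ℂ)) : ℝ → ℂ) = (f : ℝ → ℂ) ∘ fun v => v + h := by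
    ext x; simp
  rw [h1]
  have := congrFun (VectorFourier.fourierIntegral_comp_add_right Real.fourierChar volume
    (innerₗ ℝ) (f : ℝ → ℂ) h) η
  rw [Circle.smul_def] at this
  rw [Real.fourier_eq, Real.fourier_eq]
  simpa [VectorFourier.fourierIntegral, mul_comm] using this

/-- The Fourier transform turns the difference `f(· + h) - f` into a multiplication. -/
theorem norm_translate_sub (h : ℝ) (f : L2) :
    ‖translate h f - f‖ = ‖mulOp (diffSymbol h) (𝓕 f)‖ := by
  refine DenseRange.induction_on
    (p := fun f : L2 => ‖translate h f - f‖ = ‖mulOp (diffSymbol h) (𝓕 f)‖)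
    (SchwartzMap.denseRange_toLpCLM (p := 2) ENNReal.ofNat_ne_top) f ?_ ?_
  · apply isClosed_eq
    · exact ((continuous_translate h).sub continuous_id).norm
    · exact ((mulOp (diffSymbol h)).continuous.comp
        (Lp.fourierTransformₗᵢ ℝ ℂ).continuous).norm
  intro f
  rw [SchwartzMap.toLpCLM_apply]
  have h1 : translate h (f.toLp 2 volume) - f.toLp 2 volume =
      (f.compSubConstCLM ℂ (-h) - f).toLp 2 volume := by
    apply Lp.ext
    have h3 := (measurePreserving_add_right (volume : Measure ℝ) h).quasiMeasurePreserving.ae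
      (f.coeFn_toLp 2 volume)
    filter_upwards [Lp.coeFn_sub (translate h (f.toLp 2)) (f.toLp 2), translate_coe h (f.toLp 2),
      f.coeFn_toLp 2 volume, h3, (f.compSubConstCLM ℂ (-h) - f).coeFn_toLp 2 volume]
      with x e1 e2 e3 e4 e5
    rw [e1, Pi.sub_apply, e2, e3, e4, e5]
    simp
  have h2 : ∀ x, ‖𝓕 (f.compSubConstCLM ℂ (-h) - f) x‖ = diffSymbol h x * ‖𝓕 f x‖ := by
    intro x
    rw [← norm_phase_sub_one, ← norm_mul, sub_mul, ← fourier_translate_schwartz, one_mul]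
    congr 1
    rw [← _root_.sub_apply]
    congr 1
    exact map_sub (FourierTransform.fourierCLM ℂ 𝓢(ℝ, ℂ)) _ _
  rw [h1, ← Lp.norm_fourier_eq, SchwartzMap.toLp_fourier_eq, SchwartzMap.toLp_fourier_eq,
    Lp.norm_def, Lp.norm_def]
  congr 1
  apply eLpNorm_congr_norm_ae
  filter_upwards [(𝓕 (f.compSubConstCLM ℂ (-h) - f)).coeFn_toLp 2 volume,
    (𝓕 f).coeFn_toLp 2 volume, mulOp_coe (bddMeas_diffSymbol h) ((𝓕 f).toLp 2)] with x e1 e2 e3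
  rw [e1, e3, e2, h2, norm_mul, Complex.norm_real, Real.norm_eq_abs,
    abs_of_nonneg (diffSymbol_nonneg h x)]

theorem diffSymbol_abs (h η : ℝ) : diffSymbol h |η| = diffSymbol h η := by
  rcases abs_choice η with e | e <;> rw [e]
  simp [diffSymbol]

theorem diffSymbol_le (h η : ℝ) : diffSymbol h η ≤ 2 * Real.pi * |h| * |η| := by
  unfold diffSymbol
  have := Real.abs_sin_le_abs (x := Real.pi * h * η)
  rw [abs_mul, abs_mul, abs_of_pos Real.pi_pos] at this
  linarith

/-- The integrand of the constant that relates the fractional difference seminorm to the weight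
`|η|^(2σ)`. -/
def fracKernel (σ : ℝ) : ℝ → ℝ≥0∞ :=
  (Ioi (0 : ℝ)).indicator fun x => ENNReal.ofReal (diffSymbol 1 x ^ 2 * x ^ (-1 - 2 * σ))

theorem measurable_fracKernel (σ : ℝ) : Measurable (fracKernel σ) := by
  refine Measurable.indicator ?_ measurableSet_Ioi
  unfold diffSymbol
  fun_prop

theorem lintegral_fracKernel_ne_top {σ : ℝ} (h0 : 0 < σ) (h1 : σ < 1) :
    ∫⁻ x, fracKernel σ x ≠ ∞ := by
  unfold fracKernel
  rw [lintegral_indicator measurableSet_Ioi, ← Ioc_union_Ioi_eq_Ioi (zero_le_one (α := ℝ))]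
  refine ((lintegral_union_le _ _ _).trans_lt (ENNReal.add_lt_top.2 ⟨?_, ?_⟩)).ne
  · have hi : IntegrableOn (fun x : ℝ => 4 * Real.pi ^ 2 * x ^ (1 - 2 * σ)) (Ioc 0 1) := by
      have := (intervalIntegral.intervalIntegrable_rpow' (a := 0) (b := 1) (r := 1 - 2 * σ)
        (by linarith)).const_mul (4 * Real.pi ^ 2)
      exact (intervalIntegrable_iff_integrableOn_Ioc_of_le zero_le_one).1 this
    refine lt_of_le_of_lt (setLIntegral_mono' measurableSet_Ioc fun x hx => ?_)
      hi.lintegral_lt_top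
    apply ENNReal.ofReal_le_ofReal
    have e : x ^ (1 - 2 * σ) = x ^ 2 * x ^ (-1 - 2 * σ) := by
      rw [← Real.rpow_natCast, ← Real.rpow_add hx.1]; congr 1; push_cast; ring
    rw [e]
    have h3 := diffSymbol_le 1 x
    rw [abs_one, abs_of_pos hx.1] at h3
    have h4 : diffSymbol 1 x ^ 2 ≤ (2 * Real.pi * 1 * x) ^ 2 :=
      pow_le_pow_left₀ (diffSymbol_nonneg _ _) h3 2
    calc _ ≤ (2 * Real.pi * 1 * x) ^ 2 * x ^ (-1 - 2 * σ) := by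
          gcongr
          exact Real.rpow_nonneg hx.1.le _
      _ = _ := by ring
  · have hi : IntegrableOn (fun x : ℝ => 4 * x ^ (-1 - 2 * σ)) (Ioi 1) :=
      (integrableOn_Ioi_rpow_of_lt (by linarith) zero_lt_one).const_mul 4
    refine lt_of_le_of_lt (setLIntegral_mono' measurableSet_Ioi fun x hx => ?_)
      hi.lintegral_lt_top
    apply ENNReal.ofReal_le_ofReal
    have h3 : diffSymbol 1 x ≤ 2 := by
      have := Real.abs_sin_le_one (Real.pi * 1 * x)
      unfold diffSymbol; linarith
    have h4 : diffSymbol 1 x ^ 2 ≤ 2 ^ 2 := pow_le_pow_left₀ (diffSymbol_nonneg _ _) h3 2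
    have : (0 : ℝ) < x := zero_lt_one.trans hx
    calc _ ≤ 2 ^ 2 * x ^ (-1 - 2 * σ) := by gcongr
      _ = _ := by norm_num

theorem lintegral_fracKernel_ne_zero (σ : ℝ) : ∫⁻ x, fracKernel σ x ≠ 0 := by
  refine (lintegral_pos_iff_support (measurable_fracKernel σ)).2 ?_ |>.ne'
  refine lt_of_lt_of_le (b := volume (Ioo (0 : ℝ) 1)) (by simp) (measure_mono fun x hx => ?_)
  rw [Function.mem_support, fracKernel, indicator_of_mem (mem_Ioi.2 hx.1)]
  have : 0 < Real.sin (Real.pi * 1 * x) := by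
    apply Real.sin_pos_of_pos_of_lt_pi
    · have := Real.pi_pos; have := hx.1; positivity
    · have := Real.pi_pos; have := hx.2; nlinarith
  have h2 : 0 < x ^ (-1 - 2 * σ) := Real.rpow_pos_of_pos hx.1 _
  have h3 : 0 < diffSymbol 1 x := by unfold diffSymbol; positivity
  simp only [ne_eq, ENNReal.ofReal_eq_zero, not_le]
  positivity

/-- The average of the difference symbols over all steps, by the scaling `h ↦ |η| h`. -/
theorem lintegral_diffSymbol_mul_rpow {σ : ℝ} (h0 : 0 < σ) (η : ℝ) :
    ∫⁻ h in Ioi (0 : ℝ), ENNReal.ofReal (diffSymbol h η ^ 2) * ENNReal.ofReal (h ^ (-1 - 2 * σ)) =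
      ENNReal.ofReal (|η| ^ (2 * σ)) * ∫⁻ x, fracKernel σ x := by
  rcases eq_or_ne η 0 with rfl | hη
  · have : (0 : ℝ) ^ (2 * σ) = 0 := Real.zero_rpow (by linarith)
    simp [diffSymbol, this]
  have hη' : 0 < |η| := abs_pos.2 hη
  have hs : ∫⁻ x, fracKernel σ x = ENNReal.ofReal |η| * ∫⁻ h, fracKernel σ (|η| * h) := by
    conv_lhs => rw [← Real.smul_map_volume_mul_left hη'.ne', lintegral_smul_measure,
      lintegral_map (measurable_fracKernel σ) (by fun_prop), smul_eq_mul, abs_abs]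
  rw [hs, ← lintegral_indicator measurableSet_Ioi, ← mul_assoc,
    ← ENNReal.ofReal_mul (by positivity), ← lintegral_const_mul' _ _ ENNReal.ofReal_ne_top]
  congr 1
  funext h
  by_cases hh : h ∈ Ioi (0 : ℝ)
  · have hh' : (0 : ℝ) < h := hh
    rw [indicator_of_mem hh, fracKernel, indicator_of_mem (by exact mul_pos hη' hh'),
      ← ENNReal.ofReal_mul (by positivity), ← ENNReal.ofReal_mul (by positivity)]
    congr 1
    rw [← diffSymbol_abs h η]
    have e1 : diffSymbol 1 (|η| * h) = diffSymbol h |η| := by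
      unfold diffSymbol; congr 3; ring
    rw [e1, Real.mul_rpow hη'.le hh'.le]
    have e2 : |η| ^ (2 * σ) * |η| * |η| ^ (-1 - 2 * σ) = 1 := by
      nth_rewrite 2 [← Real.rpow_one |η|]
      rw [← Real.rpow_add hη', ← Real.rpow_add hη',
        show 2 * σ + 1 + (-1 - 2 * σ) = 0 by ring, Real.rpow_zero]
    linear_combination (-(diffSymbol h |η| ^ 2 * h ^ (-1 - 2 * σ))) * e2
  · have : |η| * h ∉ Ioi (0 : ℝ) := by
      simp only [mem_Ioi, not_lt] at hh ⊢
      exact mul_nonpos_of_nonneg_of_nonpos hη'.le hh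
    rw [indicator_of_notMem hh, fracKernel, indicator_of_notMem this, mul_zero]

/-- If all difference seminorms of one spectral density are bounded by those of another one, then so
are the fractional homogeneous Sobolev seminorms of order `σ ∈ (0, 1]`. For `σ < 1` these are
averages of the difference seminorms, for `σ = 1` a limit of difference quotients. -/
theorem lintegral_rpow_mul_le {σ : ℝ} (h0 : 0 < σ) (h1 : σ ≤ 1) {F F' : ℝ → ℝ≥0∞}
    (hF : AEMeasurable F volume) (hF' : AEMeasurable F' volume)
    (h : ∀ h, ∫⁻ η, ENNReal.ofReal (diffSymbol h η ^ 2) * F η ≤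
      ∫⁻ η, ENNReal.ofReal (diffSymbol h η ^ 2) * F' η) :
    ∫⁻ η, ENNReal.ofReal (|η| ^ (2 * σ)) * F η ≤ ∫⁻ η, ENNReal.ofReal (|η| ^ (2 * σ)) * F' η := by
  rcases h1.lt_or_eq with h1 | rfl
  · set c := ∫⁻ x, fracKernel σ x with hc
    have hc0 : c ≠ 0 := lintegral_fracKernel_ne_zero σ
    have hct : c ≠ ∞ := lintegral_fracKernel_ne_top h0 h1
    have key : ∀ F : ℝ → ℝ≥0∞, AEMeasurable F volume →
        ∫⁻ h in Ioi (0 : ℝ), (∫⁻ η, ENNReal.ofReal (diffSymbol h η ^ 2) * F η) *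
          ENNReal.ofReal (h ^ (-1 - 2 * σ)) =
        (∫⁻ η, ENNReal.ofReal (|η| ^ (2 * σ)) * F η) * c := by
      intro F hF
      have hm : Measurable fun p : ℝ × ℝ => ENNReal.ofReal (diffSymbol p.1 p.2 ^ 2) := by
        unfold diffSymbol; fun_prop
      calc _ = ∫⁻ h in Ioi (0 : ℝ), ∫⁻ η, (ENNReal.ofReal (diffSymbol h η ^ 2) * F η) *
          ENNReal.ofReal (h ^ (-1 - 2 * σ)) := by
            congr 1; ext h; rw [lintegral_mul_const' _ _ ENNReal.ofReal_ne_top]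
        _ = ∫⁻ η, ∫⁻ h in Ioi (0 : ℝ), (ENNReal.ofReal (diffSymbol h η ^ 2) * F η) *
          ENNReal.ofReal (h ^ (-1 - 2 * σ)) := by
            apply lintegral_lintegral_swap
            refine (hm.aemeasurable.mul ?_).mul ?_
            · exact hF.comp_snd
            · exact Measurable.aemeasurable (by fun_prop)
        _ = ∫⁻ η, (ENNReal.ofReal (|η| ^ (2 * σ)) * F η) * c := by
            congr 1; ext η
            have : ∀ h : ℝ, ENNReal.ofReal (diffSymbol h η ^ 2) * F η *
                ENNReal.ofReal (h ^ (-1 - 2 * σ)) = (ENNReal.ofReal (diffSymbol h η ^ 2) *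
                ENNReal.ofReal (h ^ (-1 - 2 * σ))) * F η := fun h => by ring
            simp_rw [this]
            rw [lintegral_mul_const _ (by unfold diffSymbol; fun_prop),
              lintegral_diffSymbol_mul_rpow h0]
            ring
        _ = _ := lintegral_mul_const' _ _ hct
    rw [← ENNReal.mul_le_mul_iff_left hc0 hct, ← key F hF, ← key F' hF']
    exact lintegral_mono fun h' => mul_le_mul_left (h h') _
  -- For `σ = 1` the weight `|η|²` is the limit of the difference quotients with the steps
  -- `h = 1/(n+1)`, each of which is at most `|η|²`.
  · have hpi : (2 * Real.pi) ^ 2 ≠ 0 := by positivity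
    set q : ℕ → ℝ → ℝ≥0∞ := fun n η =>
      ENNReal.ofReal (((n + 1 : ℝ) * diffSymbol (1 / (n + 1)) η / (2 * Real.pi)) ^ 2) with hq
    have hle : ∀ n η, q n η ≤ ENNReal.ofReal (|η| ^ (2 * (1 : ℝ))) := by
      intro n η
      apply ENNReal.ofReal_le_ofReal
      have e : |η| ^ (2 * (1 : ℝ)) = |η| ^ 2 := by norm_num
      rw [e]
      have := diffSymbol_le (1 / (n + 1)) η
      rw [abs_of_pos (by positivity : (0 : ℝ) < 1 / (n + 1))] at this
      have := diffSymbol_nonneg (1 / (n + 1)) η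
      gcongr
      rw [div_le_iff₀ (by positivity)]
      calc (n + 1 : ℝ) * diffSymbol (1 / (n + 1)) η
          ≤ (n + 1) * (2 * Real.pi * (1 / (n + 1)) * |η|) := by gcongr
        _ = _ := by field_simp
    have hlim : ∀ η, Tendsto (fun n => q n η) atTop (𝓝 (ENNReal.ofReal (|η| ^ (2 * (1 : ℝ))))) := by
      intro η
      apply ENNReal.tendsto_ofReal
      have e : |η| ^ (2 * (1 : ℝ)) = |η| ^ 2 := by norm_num
      rw [e]
      apply Tendsto.pow
      have hs : Tendsto (fun n : ℕ => (1 : ℝ) / (n + 1)) atTop (𝓝 0) :=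
        tendsto_one_div_add_atTop_nhds_zero_nat
      have hd : HasDerivAt (fun y : ℝ => Real.sin (Real.pi * y * η)) (Real.pi * η) 0 := by
        have h1 : HasDerivAt (fun y : ℝ => Real.pi * y * η) (Real.pi * η) 0 := by
          simpa using ((hasDerivAt_id (0 : ℝ)).const_mul Real.pi).mul_const η
        simpa using h1.sin
      have hs' : Tendsto (fun n : ℕ => (1 : ℝ) / (n + 1)) atTop (𝓝[≠] 0) :=
        tendsto_nhdsWithin_iff.2 ⟨hs, Eventually.of_forall fun n => by
          simp only [mem_compl_iff, mem_singleton_iff]; positivity⟩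
      have h2 := ((hasDerivAt_iff_tendsto_slope.1 hd).comp hs').abs
      have h3 := h2.div_const Real.pi
      have e3 : |Real.pi * η| / Real.pi = |η| := by
        rw [abs_mul, abs_of_pos Real.pi_pos]; field_simp
      rw [e3] at h3
      refine h3.congr fun n => ?_
      have : (0 : ℝ) < n + 1 := by positivity
      simp only [Function.comp, slope_def_field, diffSymbol]
      simp only [mul_zero, zero_mul, Real.sin_zero, sub_zero]
      rw [abs_div, abs_of_pos (by positivity : (0 : ℝ) < 1 / (n + 1))]
      field_simp
    have hmq : ∀ n, Measurable (q n) := fun n => by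
      simp only [hq]; unfold diffSymbol; fun_prop
    calc ∫⁻ η, ENNReal.ofReal (|η| ^ (2 * (1 : ℝ))) * F η
        ≤ ∫⁻ η, liminf (fun n => q n η * F η) atTop := by
          apply lintegral_mono
          intro η
          apply le_of_eq
          symm
          apply Tendsto.liminf_eq
          rcases eq_or_ne η 0 with rfl | hη
          · have : ∀ n, q n 0 = 0 := fun n => by simp [hq, diffSymbol]
            simp [this]
          · apply ENNReal.Tendsto.mul_const (hlim η)
            left
            simp only [ne_eq, ENNReal.ofReal_eq_zero, not_le]
            have := abs_pos.2 hη
            positivity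
      _ ≤ liminf (fun n => ∫⁻ η, q n η * F η) atTop :=
          lintegral_liminf_le' fun n => (hmq n).aemeasurable.mul hF
      _ ≤ _ := by
          apply liminf_le_of_le (by isBoundedDefault)
          intro b hb
          obtain ⟨n, hn⟩ := hb.exists
          refine hn.trans ?_
          have e : ∀ F : ℝ → ℝ≥0∞, ∫⁻ η, q n η * F η =
              ENNReal.ofReal (((n + 1 : ℝ) / (2 * Real.pi)) ^ 2) *
              ∫⁻ η, ENNReal.ofReal (diffSymbol (1 / (n + 1)) η ^ 2) * F η := by
            intro F
            rw [← lintegral_const_mul' _ _ ENNReal.ofReal_ne_top]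
            congr 1; ext η
            rw [← mul_assoc, ← ENNReal.ofReal_mul (by positivity)]
            simp only [hq]
            congr 2
            ring
          calc _ ≤ ∫⁻ η, q n η * F' η := by
                rw [e, e]; exact mul_le_mul_right (h _) _
            _ ≤ _ := by gcongr with η; exact hle n η

/-! ### The nonlinearity on the Fourier side -/

section Superposition

theorem inner_fourier_fourier (f g : L2) : ⟪𝓕 f, 𝓕 g⟫_ℝ = ⟪f, g⟫_ℝ := by
  rw [real_inner_eq_norm_add_mul_self_sub_norm_mul_self_sub_norm_mul_self_div_two,
    real_inner_eq_norm_add_mul_self_sub_norm_mul_self_sub_norm_mul_self_div_two,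
    ← FourierTransform.fourier_add, Lp.norm_fourier_eq, Lp.norm_fourier_eq, Lp.norm_fourier_eq]

theorem norm_fourierInv_eq (f : L2) : ‖𝓕⁻ f‖ = ‖f‖ := (Lp.fourierTransformₗᵢ ℝ ℂ).symm.norm_map f

theorem fourierInv_sub_eq (f g : L2) : 𝓕⁻ (f - g) = 𝓕⁻ f - 𝓕⁻ g :=
  map_sub (Lp.fourierTransformₗᵢ ℝ ℂ).symm f g

theorem fourier_sub_eq (f g : L2) : 𝓕 (f - g) = 𝓕 f - 𝓕 g :=
  map_sub (Lp.fourierTransformₗᵢ ℝ ℂ) f g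

theorem lipschitzWith_comp_re {γ : ℝ → ℝ} {K : ℝ≥0} (hK : LipschitzWith K γ) :
    LipschitzWith K fun z : ℂ => (γ z.re : ℂ) := by
  refine LipschitzWith.of_dist_le_mul fun z w => ?_
  rw [Complex.dist_eq, ← Complex.ofReal_sub, Complex.norm_real, ← dist_eq_norm]
  refine (hK.dist_le_mul _ _).trans ?_
  gcongr
  rw [Real.dist_eq, Complex.dist_eq, ← Complex.sub_re]
  exact Complex.abs_re_le_norm _

variable {γ : ℝ → ℝ} {K : ℝ≥0}

/-- The superposition operator `f ↦ γ(Re f)` on `L²`, for a Lipschitz function `γ` with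
`γ 0 = 0`. -/
def superposition (hK : LipschitzWith K γ) (h0 : γ 0 = 0) (f : L2) : L2 :=
  (lipschitzWith_comp_re hK).compLp (by simp [h0]) f

theorem superposition_coe (hK : LipschitzWith K γ) (h0 : γ 0 = 0) (f : L2) :
    superposition hK h0 f =ᵐ[volume] fun x => (γ (f x).re : ℂ) :=
  (lipschitzWith_comp_re hK).coeFn_compLp _ f

theorem norm_superposition_sub_le (hK : LipschitzWith K γ) (h0 : γ 0 = 0) (f g : L2) :
    ‖superposition hK h0 f - superposition hK h0 g‖ ≤ K * ‖f - g‖ :=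
  (lipschitzWith_comp_re hK).norm_compLp_sub_le _ f g

theorem superposition_translate (hK : LipschitzWith K γ) (h0 : γ 0 = 0) (h : ℝ) (f : L2) :
    superposition hK h0 (translate h f) = translate h (superposition hK h0 f) := by
  apply Lp.ext
  have h3 := (measurePreserving_add_right (volume : Measure ℝ) h).quasiMeasurePreserving.ae
    (superposition_coe hK h0 f)
  filter_upwards [superposition_coe hK h0 (translate h f), translate_coe h f,
    translate_coe h (superposition hK h0 f), h3] with x e1 e2 e3 e4
  rw [e1, e2, e3, e4]

/-- The superposition operator of `γ`, conjugated by the Fourier transform. -/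
def fourierSuperposition (hK : LipschitzWith K γ) (h0 : γ 0 = 0) (U : L2) : L2 :=
  𝓕 (superposition hK h0 (𝓕⁻ U))

theorem norm_fourierSuperposition_sub_le (hK : LipschitzWith K γ) (h0 : γ 0 = 0) (U U' : L2) :
    ‖fourierSuperposition hK h0 U - fourierSuperposition hK h0 U'‖ ≤ K * ‖U - U'‖ := by
  unfold fourierSuperposition
  rw [← fourier_sub_eq, Lp.norm_fourier_eq, ← norm_fourierInv_eq (U - U'), fourierInv_sub_eq]
  exact norm_superposition_sub_le hK h0 _ _

theorem continuous_fourierSuperposition (hK : LipschitzWith K γ) (h0 : γ 0 = 0) :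
    Continuous (fourierSuperposition hK h0) :=
  (LipschitzWith.of_dist_le_mul (K := K) fun U U' => by
    rw [dist_eq_norm, dist_eq_norm]
    exact norm_fourierSuperposition_sub_le hK h0 U U').continuous

/-- A Lipschitz superposition does not increase the difference seminorms by more than its Lipschitz
constant. -/
theorem norm_diffSymbol_fourierSuperposition_le (hK : LipschitzWith K γ) (h0 : γ 0 = 0) (h : ℝ)
    (U : L2) :
    ‖mulOp (diffSymbol h) (fourierSuperposition hK h0 U)‖ ≤ K * ‖mulOp (diffSymbol h) U‖ := by
  unfold fourierSuperposition
  rw [← norm_translate_sub, ← superposition_translate]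
  refine (norm_superposition_sub_le hK h0 _ _).trans ?_
  rw [norm_translate_sub, FourierTransform.fourier_fourierInv_eq]

theorem abs_primitive_sub_le (hK : LipschitzWith K γ) (a b : ℝ) :
    |primitive γ b - primitive γ a - γ a * (b - a)| ≤ K * (b - a) ^ 2 := by
  have hc := hK.continuous
  have h1 : primitive γ b - primitive γ a - γ a * (b - a) = ∫ p in a..b, (γ p - γ a) := by
    unfold primitive
    rw [intervalIntegral.integral_sub (hc.intervalIntegrable _ _) (by simp),
      intervalIntegral.integral_const,
      ← intervalIntegral.integral_interval_sub_left (hc.intervalIntegrable 0 b)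
        (hc.intervalIntegrable 0 a), smul_eq_mul]
    ring
  rw [h1, ← Real.norm_eq_abs]
  have h2 : ∀ p ∈ uIoc a b, ‖γ p - γ a‖ ≤ K * |b - a| := by
    intro p hp
    rw [← dist_eq_norm]
    refine (hK.dist_le_mul p a).trans ?_
    gcongr
    rw [Real.dist_eq]
    exact abs_sub_left_of_mem_uIcc (uIoc_subset_uIcc hp)
  refine (intervalIntegral.norm_integral_le_of_norm_le_const h2).trans (le_of_eq ?_)
  rw [mul_assoc, ← abs_mul, ← sq, abs_sq]

theorem primitive_zero (γ : ℝ → ℝ) : primitive γ 0 = 0 := by simp [primitive]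

theorem abs_primitive_le (hK : LipschitzWith K γ) (h0 : γ 0 = 0) (y : ℝ) :
    |primitive γ y| ≤ K * y ^ 2 := by
  have := abs_primitive_sub_le hK 0 y
  simpa [primitive_zero, h0] using this

theorem continuous_primitive (hK : LipschitzWith K γ) : Continuous (primitive γ) :=
  intervalIntegral.continuous_primitive (fun a b => hK.continuous.intervalIntegrable a b) 0

theorem re_sq_le_norm_sq (z : ℂ) : z.re ^ 2 ≤ ‖z‖ ^ 2 := by
  rw [← sq_abs]
  exact pow_le_pow_left₀ (abs_nonneg _) (Complex.abs_re_le_norm z) 2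

theorem integrable_norm_sq (f : L2) : Integrable fun x => ‖f x‖ ^ 2 :=
  (memLp_two_iff_integrable_sq_norm (Lp.aestronglyMeasurable f)).1 (Lp.memLp f)

theorem norm_sq_eq_integral (f : L2) : ‖f‖ ^ 2 = ∫ x, ‖f x‖ ^ 2 := by
  rw [← real_inner_self_eq_norm_sq, inner_eq_integral]
  simp

theorem integrable_primitive_re (hK : LipschitzWith K γ) (h0 : γ 0 = 0) (f : L2) :
    Integrable fun x => primitive γ (f x).re := by
  refine ((integrable_norm_sq f).const_mul K).mono' ?_ (ae_of_all _ fun x => ?_)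
  · exact (continuous_primitive hK).comp_aestronglyMeasurable
      (Complex.continuous_re.comp_aestronglyMeasurable (Lp.aestronglyMeasurable f))
  · refine (abs_primitive_le hK h0 _).trans ?_
    exact mul_le_mul_of_nonneg_left (re_sq_le_norm_sq _) K.2

/-- The potential energy `∫ Γ(Re u)` with `Γ' = γ`, `Γ(0) = 0`, as a functional of the Fourier
transform of `u`. -/
def potential (γ : ℝ → ℝ) (U : L2) : ℝ := ∫ x, primitive γ ((𝓕⁻ U : L2) x).re

/-- The superposition operator is the derivative of the potential energy, with a quadratic error. -/
theorem abs_potential_sub_le (hK : LipschitzWith K γ) (h0 : γ 0 = 0) (U U' : L2) :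
    |potential γ U' - potential γ U - ⟪fourierSuperposition hK h0 U, U' - U⟫_ℝ| ≤
      K * ‖U' - U‖ ^ 2 := by
  set f : L2 := 𝓕⁻ U with hf
  set f' : L2 := 𝓕⁻ U' with hf'
  have e1 : ⟪fourierSuperposition hK h0 U, U' - U⟫_ℝ = ⟪superposition hK h0 f, f' - f⟫_ℝ := by
    rw [← inner_fourier_fourier (superposition hK h0 f), fourier_sub_eq, hf, hf',
      FourierTransform.fourier_fourierInv_eq, FourierTransform.fourier_fourierInv_eq]
    rfl
  have e2 : ‖U' - U‖ = ‖f' - f‖ := by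
    rw [← norm_fourierInv_eq, fourierInv_sub_eq]
  rw [e1, e2, norm_sq_eq_integral, inner_eq_integral]
  unfold potential
  rw [← hf, ← hf', ← integral_sub (integrable_primitive_re hK h0 f')
    (integrable_primitive_re hK h0 f), ← integral_sub (f := fun x => primitive γ (f' x).re - primitive γ (f x).re)
    ((integrable_primitive_re hK h0 f').sub (integrable_primitive_re hK h0 f))
    (L2.integrable_inner (𝕜 := ℝ) _ _), ← integral_const_mul, ← Real.norm_eq_abs]
  refine norm_integral_le_of_norm_le ((integrable_norm_sq _).const_mul K) ?_
  filter_upwards [superposition_coe hK h0 f, Lp.coeFn_sub f' f] with x h1 h2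
  rw [h1, h2, Pi.sub_apply, Complex.inner]
  have : ((f' x - f x) * (starRingEnd ℂ) (γ (f x).re : ℂ)).re =
      γ (f x).re * ((f' x).re - (f x).re) := by simp [mul_comm]
  rw [this]
  refine (abs_primitive_sub_le hK _ _).trans ?_
  rw [← Complex.sub_re]
  exact mul_le_mul_of_nonneg_left (re_sq_le_norm_sq _) K.2

/-- The gradient of the potential energy is the superposition operator. -/
theorem hasFDerivAt_potential (hK : LipschitzWith K γ) (h0 : γ 0 = 0) (U : L2) :
    HasFDerivAt (potential γ) (innerSL ℝ (fourierSuperposition hK h0 U)) U := by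
  apply HasFDerivAt.of_isLittleO
  have h1 : (fun U' => potential γ U' - potential γ U -
      innerSL ℝ (fourierSuperposition hK h0 U) (U' - U)) =O[𝓝 U] fun U' => ‖U' - U‖ ^ 2 := by
    refine Asymptotics.IsBigO.of_bound K (Eventually.of_forall fun U' => ?_)
    rw [norm_pow, norm_norm, Real.norm_eq_abs]
    exact abs_potential_sub_le hK h0 U U'
  refine h1.trans_isLittleO ?_
  have h2 : (fun U' : L2 => U' - U) =o[𝓝 U] fun _ => (1 : ℝ) := by
    rw [Asymptotics.isLittleO_one_iff]
    exact tendsto_sub_nhds_zero_iff.2 tendsto_id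
  have h3 := h2.norm_left.mul_isBigO (Asymptotics.isBigO_refl (fun U' : L2 => U' - U) (𝓝 U)).norm_norm
  simpa [sq] using h3

theorem continuous_potential (hK : LipschitzWith K γ) (h0 : γ 0 = 0) : Continuous (potential γ) :=
  continuous_iff_continuousAt.2 fun U => (hasFDerivAt_potential hK h0 U).continuousAt

end Superposition

/-! ### Gronwall inequalities -/

theorem hasDerivAt_integral_of_continuousOn {f : ℝ → ℝ} {T t : ℝ} (hf : ContinuousOn f (Icc 0 T))
    (ht : t ∈ Ioo 0 T) : HasDerivAt (fun x => ∫ τ in (0 : ℝ)..x, f τ) (f t) t := by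
  have hI : Icc 0 T ∈ 𝓝 t := Icc_mem_nhds ht.1 ht.2
  refine intervalIntegral.integral_hasDerivAt_right ?_ ?_ (hf.continuousAt hI)
  · refine (hf.mono ?_).intervalIntegrable
    rw [uIcc_of_le ht.1.le]
    exact Icc_subset_Icc_right ht.2.le
  · exact hf.stronglyMeasurableAtFilter_nhdsWithin measurableSet_Icc t |>.filter_mono
      (by rw [nhdsWithin_eq_nhds.2 hI])

theorem continuousOn_integral_of_continuousOn {f : ℝ → ℝ} {T : ℝ} (hT : 0 ≤ T)
    (hf : ContinuousOn f (Icc 0 T)) :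
    ContinuousOn (fun x => ∫ τ in (0 : ℝ)..x, f τ) (Icc 0 T) := by
  have := intervalIntegral.continuousOn_primitive_interval (f := f) (a := 0) (b := T)
    (μ := volume) ?_
  · rwa [uIcc_of_le hT] at this
  · rw [uIcc_of_le hT]; exact hf.integrableOn_Icc

/-- Gronwall's inequality for the differential inequality `E' ≤ E + f`. -/
theorem le_exp_mul_of_deriv_le {E E' f : ℝ → ℝ} {T : ℝ} (hE : ContinuousOn E (Icc 0 T))
    (hf : ContinuousOn f (Icc 0 T)) (hf0 : ∀ t, 0 ≤ f t)
    (hd : ∀ t ∈ Ioo 0 T, HasDerivAt E (E' t) t) (hle : ∀ t ∈ Ioo 0 T, E' t ≤ E t + f t)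
    {t : ℝ} (ht : t ∈ Icc 0 T) : E t ≤ Real.exp t * (E 0 + ∫ τ in (0 : ℝ)..t, f τ) := by
  have hT : 0 ≤ T := ht.1.trans ht.2
  have hanti : AntitoneOn (fun t => Real.exp (-t) * E t - ∫ τ in (0 : ℝ)..t, f τ) (Icc 0 T) := by
    have hder : ∀ t ∈ Ioo 0 T, HasDerivAt (fun t => Real.exp (-t) * E t - ∫ τ in (0 : ℝ)..t, f τ)
        (Real.exp (-t) * (-1) * E t + Real.exp (-t) * E' t - f t) t := fun t ht =>
      (((hasDerivAt_neg t).exp).mul (hd t ht)).sub (hasDerivAt_integral_of_continuousOn hf ht)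
    apply antitoneOn_of_deriv_nonpos (convex_Icc 0 T)
    · exact ((Real.continuous_exp.comp continuous_neg).continuousOn.mul hE).sub
        (continuousOn_integral_of_continuousOn hT hf)
    · rw [interior_Icc]
      exact fun t ht => (hder t ht).differentiableAt.differentiableWithinAt
    · rw [interior_Icc]
      intro t ht
      rw [(hder t ht).deriv]
      have h1 : Real.exp (-t) ≤ 1 := Real.exp_le_one_iff.2 (by linarith [ht.1])
      have h2 := mul_le_mul_of_nonneg_left (hle t ht) (Real.exp_pos (-t)).le
      have h3 := mul_le_mul_of_nonneg_right h1 (hf0 t)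
      nlinarith
  have h := hanti (left_mem_Icc.2 hT) ht ht.1
  simp only [neg_zero, Real.exp_zero, one_mul, intervalIntegral.integral_same, sub_zero] at h
  have h2 : Real.exp (-t) * E t ≤ E 0 + ∫ τ in (0 : ℝ)..t, f τ := by linarith
  calc E t = Real.exp t * (Real.exp (-t) * E t) := by
        rw [← mul_assoc, ← Real.exp_add]; simp
    _ ≤ _ := by gcongr

/-- Gronwall's inequality in integral form. -/
theorem le_mul_exp_of_le_integral {f : ℝ → ℝ} {T A K : ℝ} (hK : 0 ≤ K)
    (hf : ContinuousOn f (Icc 0 T)) (hle : ∀ t ∈ Icc 0 T, f t ≤ A + K * ∫ τ in (0 : ℝ)..t, f τ)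
    {t : ℝ} (ht : t ∈ Icc 0 T) : f t ≤ A * Real.exp (K * t) := by
  have hT : 0 ≤ T := ht.1.trans ht.2
  have hanti : AntitoneOn (fun t => Real.exp (-(K * t)) * (A + K * ∫ τ in (0 : ℝ)..t, f τ))
      (Icc 0 T) := by
    have hder : ∀ t ∈ Ioo 0 T, HasDerivAt
        (fun t => Real.exp (-(K * t)) * (A + K * ∫ τ in (0 : ℝ)..t, f τ))
        (Real.exp (-(K * t)) * (-(K * 1)) * (A + K * ∫ τ in (0 : ℝ)..t, f τ) +
          Real.exp (-(K * t)) * (K * f t)) t := fun t ht =>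
      (((hasDerivAt_id t).const_mul K).neg.exp).mul
        (((hasDerivAt_integral_of_continuousOn hf ht).const_mul K).const_add A)
    apply antitoneOn_of_deriv_nonpos (convex_Icc 0 T)
    · exact (by fun_prop : Continuous fun t => Real.exp (-(K * t))).continuousOn.mul
        (continuousOn_const.add
          (continuousOn_const.mul (continuousOn_integral_of_continuousOn hT hf)))
    · rw [interior_Icc]
      exact fun t ht => (hder t ht).differentiableAt.differentiableWithinAt
    · rw [interior_Icc]
      intro t ht
      rw [(hder t ht).deriv]
      have h2 := mul_le_mul_of_nonneg_left (hle t (Ioo_subset_Icc_self ht)) hK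
      have h3 := mul_le_mul_of_nonneg_left h2 (Real.exp_pos (-(K * t))).le
      nlinarith
  have h := hanti (left_mem_Icc.2 hT) ht ht.1
  simp only [mul_zero, neg_zero, Real.exp_zero, one_mul, intervalIntegral.integral_same,
    add_zero] at h
  refine (hle t ht).trans ?_
  calc A + K * ∫ τ in (0 : ℝ)..t, f τ
      = Real.exp (K * t) * (Real.exp (-(K * t)) * (A + K * ∫ τ in (0 : ℝ)..t, f τ)) := by
        rw [← mul_assoc, ← Real.exp_add]; simp
    _ ≤ Real.exp (K * t) * A := by gcongr
    _ = _ := mul_comm _ _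

/-! ### Truncated multipliers -/

/-- A measurable function that is bounded on each of the sets `S n`. -/
structure BddOn (S : ℕ → Set ℝ) (a : ℝ → ℝ) : Prop where
  meas : Measurable a
  bdd : ∀ n, ∃ C, ∀ η ∈ S n, |a η| ≤ C

namespace BddOn

variable {S : ℕ → Set ℝ} {a b : ℝ → ℝ}

theorem mul (ha : BddOn S a) (hb : BddOn S b) : BddOn S fun η => a η * b η := by
  refine ⟨ha.meas.mul hb.meas, fun n => ?_⟩
  obtain ⟨C, hC⟩ := ha.bdd n
  obtain ⟨C', hC'⟩ := hb.bdd n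
  refine ⟨C * C', fun η hη => ?_⟩
  rw [abs_mul]
  exact mul_le_mul (hC η hη) (hC' η hη) (abs_nonneg _) ((abs_nonneg _).trans (hC η hη))

theorem div (ha : BddOn S a) (hb : BddOn S fun η => (b η)⁻¹) : BddOn S fun η => a η / b η := by
  simpa only [div_eq_mul_inv] using ha.mul hb

theorem _root_.DoubleDispersive.BddMeas.bddOn (ha : BddMeas a) : BddOn S a :=
  ⟨ha.1, fun _ => ha.2.imp fun _ hC η _ => hC η⟩

theorem indicator (ha : BddOn S a) (hS : Exhaustion S) (n : ℕ) :
    BddMeas ((S n).indicator a) := by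
  obtain ⟨C, hC⟩ := ha.bdd n
  refine ⟨ha.meas.indicator (hS.meas n), |C|, fun η => ?_⟩
  by_cases hη : η ∈ S n
  · simpa [hη] using (hC η hη).trans (le_abs_self C)
  · simp [hη]

end BddOn

theorem mulOp_indicator_congr {S : ℕ → Set ℝ} (hS : Exhaustion S) {a b : ℝ → ℝ} (ha : BddOn S a)
    (hb : BddOn S b) {n : ℕ} {f g : L2} (h : ∀ᵐ η, η ∈ S n → (a η : ℂ) * f η = b η * g η) :
    mulOp ((S n).indicator a) f = mulOp ((S n).indicator b) g := by
  apply mulOp_congr (ha.indicator hS n) (hb.indicator hS n)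
  filter_upwards [h] with η h1
  by_cases hη : η ∈ S n
  · simpa [hη] using h1 hη
  · simp [hη]

theorem mulOp_indicator_mulOp {S : ℕ → Set ℝ} (hS : Exhaustion S) {a b c : ℝ → ℝ}
    (ha : BddOn S a) (hb : BddMeas b) (hc : BddOn S c) {n : ℕ}
    (h : ∀ η ∈ S n, a η * b η = c η) (f : L2) :
    mulOp ((S n).indicator a) (mulOp b f) = mulOp ((S n).indicator c) f := by
  apply mulOp_indicator_congr hS ha hc
  filter_upwards [mulOp_coe hb f] with η h1 hη
  rw [h1, ← h η hη]
  push_cast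
  ring

theorem cutoff_mulOp {S : ℕ → Set ℝ} (hS : Exhaustion S) {a : ℝ → ℝ} (ha : BddMeas a) (n : ℕ)
    (f : L2) : cutoff (S n) (mulOp a f) = mulOp ((S n).indicator a) f :=
  mulOp_indicator_mulOp hS (bddMeas_const 1).bddOn ha ha.bddOn (by simp) f

theorem mulOp_cutoff {S : ℕ → Set ℝ} (hS : Exhaustion S) {a : ℝ → ℝ} (ha : BddMeas a) (n : ℕ)
    (f : L2) : mulOp a (cutoff (S n) f) = cutoff (S n) (mulOp a f) := by
  unfold cutoff
  rw [mulOp_mulOp ha (bddMeas_indicator_one (hS.meas n)),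
    mulOp_mulOp (bddMeas_indicator_one (hS.meas n)) ha]
  simp_rw [mul_comm]

/-- The inner product of two truncated products depends only on the product of the two weights. -/
theorem inner_indicator_indicator {S : ℕ → Set ℝ} (hS : Exhaustion S) {a b c d : ℝ → ℝ}
    (ha : BddOn S a) (hb : BddOn S b) (hc : BddOn S c) (hd : BddOn S d) {n : ℕ}
    (h : ∀ η ∈ S n, a η * b η = c η * d η) (f g : L2) :
    ⟪mulOp ((S n).indicator a) f, mulOp ((S n).indicator b) g⟫_ℝ =
      ⟪mulOp ((S n).indicator c) f, mulOp ((S n).indicator d) g⟫_ℝ := by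
  rw [inner_mulOp_left (ha.indicator hS n), inner_mulOp_left (hc.indicator hS n),
    mulOp_indicator_mulOp hS ha (hb.indicator hS n) (ha.mul hb) (by intro η hη; simp [hη]),
    mulOp_indicator_mulOp hS hc (hd.indicator hS n) (hc.mul hd) (by intro η hη; simp [hη])]
  congr 1
  apply mulOp_indicator_congr hS (ha.mul hb) (hc.mul hd)
  filter_upwards with η hη
  rw [h η hη]

theorem norm_mulOp_indicator_le {S : ℕ → Set ℝ} (hS : Exhaustion S) {a b : ℝ → ℝ}
    (ha : BddOn S a) (hb : BddMeas b) {C : ℝ} (hC : 0 ≤ C) {n : ℕ}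
    (h : ∀ η ∈ S n, |a η| ≤ C * |b η|) (f : L2) :
    ‖mulOp ((S n).indicator a) f‖ ≤ C * ‖mulOp b f‖ := by
  apply norm_mulOp_le (ha.indicator hS n) hb
  filter_upwards with η
  by_cases hη : η ∈ S n
  · simpa [hη] using h η hη
  · simp only [hη, not_false_eq_true, indicator_of_notMem, abs_zero]
    positivity

/-- Weak-strong convergence: a sequence `w n → 0` in `L²` for which the truncated products with the
weight `a` stay bounded is weakly null after truncation and multiplication by `a`. -/
theorem tendsto_inner_truncated {S : ℕ → Set ℝ} (hS : Exhaustion S) {a : ℝ → ℝ} (ha : BddOn S a)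
    {w : ℕ → L2} (hw : Tendsto w atTop (𝓝 0)) {M : ℝ}
    (hM : ∀ n, ‖mulOp ((S n).indicator a) (w n)‖ ≤ M) (P : L2) :
    Tendsto (fun n => ⟪P, mulOp ((S n).indicator a) (w n)⟫_ℝ) atTop (𝓝 0) := by
  rw [Metric.tendsto_atTop]
  intro ε hε
  have hM0 : 0 ≤ M := (norm_nonneg _).trans (hM 0)
  obtain ⟨j, hj⟩ := (Metric.tendsto_atTop.1 (hS.tendsto_cutoff P)) (ε / (2 * (M + 1)))
    (by positivity)
  have hj := hj j le_rfl
  rw [dist_eq_norm, norm_sub_rev] at hj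
  have h2 : Tendsto (fun n => ⟪mulOp ((S j).indicator a) P, w n⟫_ℝ) atTop (𝓝 0) := by
    have := (tendsto_const_nhds (x := mulOp ((S j).indicator a) P)).inner (𝕜 := ℝ) hw
    simpa using this
  obtain ⟨N, hN⟩ := (Metric.tendsto_atTop.1 h2) (ε / 2) (by positivity)
  refine ⟨max N j, fun n hn => ?_⟩
  have hN := hN n ((le_max_left _ _).trans hn)
  have hjn : S j ⊆ S n := hS.mono ((le_max_right _ _).trans hn)
  rw [dist_zero_right] at hN ⊢
  -- `P` is split into a part of small norm and a part on which the weight `a` is bounded.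
  have e : ⟪P, mulOp ((S n).indicator a) (w n)⟫_ℝ =
      ⟪P - cutoff (S j) P, mulOp ((S n).indicator a) (w n)⟫_ℝ +
        ⟪mulOp ((S j).indicator a) P, w n⟫_ℝ := by
    rw [inner_sub_left, ← inner_mulOp_left (ha.indicator hS n) (cutoff (S j) P)]
    have : mulOp ((S n).indicator a) (cutoff (S j) P) = mulOp ((S j).indicator a) P := by
      unfold cutoff
      rw [mulOp_mulOp (ha.indicator hS n) (bddMeas_indicator_one (hS.meas j))]
      congr 2
      funext η
      by_cases hη : η ∈ S j
      · simp [hη, hjn hη]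
      · simp [hη]
    rw [this]
    ring
  rw [e]
  have h3 : ‖⟪P - cutoff (S j) P, mulOp ((S n).indicator a) (w n)⟫_ℝ‖ ≤ ε / 2 := by
    refine (norm_inner_le_norm _ _).trans ?_
    calc _ ≤ ε / (2 * (M + 1)) * (M + 1) := by
          gcongr
          exact (hM n).trans (by linarith)
      _ = ε / 2 := by field_simp
  calc _ ≤ _ := norm_add_le _ _
    _ < ε / 2 + ε / 2 := add_lt_add_of_le_of_lt h3 hN
    _ = ε := by ring

/-! ### The evolution of the Fourier coefficients and its energies -/

section Evolution

/-- The symbols of the equation in the frequency variable `η`: `X = 2π|η|`, `k² = l(2πη)`,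
`m² = b(2πη)`, and an auxiliary positive weight `W` that makes all the multipliers applied to the
Fourier transforms bounded. All of them, and their inverses, are bounded on the sets `S n`. The
bounds are those which the growth conditions on `l` and `b` give, with a regularity exponent
`σ`. -/
structure Symbols (S : ℕ → Set ℝ) (X k m W : ℝ → ℝ) (σ C₂ C₃ C₄ : ℝ) : Prop where
  exh : Exhaustion S
  X_pos : ∀ n, ∀ η ∈ S n, 0 < X η
  k_pos : ∀ η, 0 < k η
  m_pos : ∀ η, 0 < m η
  W_pos : ∀ η, 0 < W η
  X_bdd : BddOn S X
  X_inv : BddOn S fun η => (X η)⁻¹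
  k_bdd : BddOn S k
  k_inv : BddOn S fun η => (k η)⁻¹
  m_bdd : BddOn S m
  m_inv : BddOn S fun η => (m η)⁻¹
  W_inv : BddOn S fun η => (W η)⁻¹
  W_bdd : BddMeas W
  Wkk_bdd : BddMeas fun η => W η * X η ^ 2 * k η ^ 2
  Wmm_bdd : BddMeas fun η => W η * X η ^ 2 * m η ^ 2
  mk_bdd : BddMeas fun η => m η / k η
  σ_pos : 0 < σ
  σ_le : σ ≤ 1
  C₂_nonneg : 0 ≤ C₂
  le_C₂ : ∀ n, ∀ η ∈ S n, X η * m η ^ 2 / k η ≤ C₂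
  C₃_nonneg : 0 ≤ C₃
  le_C₃ : ∀ n, ∀ η ∈ S n, X η * m η ≤ C₃ * |η| ^ σ
  C₄_nonneg : 0 ≤ C₄
  le_C₄ : ∀ η, |η| ^ σ * (m η / k η) ≤ C₄

/-- The equation on the Fourier side: `U` is the Fourier transform of `u`, and `Y` is `W` times the
Fourier transform of `u_t`. The initial data `P₀`, `Q₀` are the two square roots of the kinetic and
the elastic energy densities at time `0`. -/
structure Evolution (X k m W : ℝ → ℝ) {γ : ℝ → ℝ} {K : ℝ≥0} (hK : LipschitzWith K γ)
    (h0 : γ 0 = 0) (T : ℝ) (U Y : ℝ → L2) (P₀ Q₀ : L2) : Prop where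
  T_nonneg : 0 ≤ T
  U_cont : ContinuousOn U (Icc 0 T)
  Y_cont : ContinuousOn Y (Icc 0 T)
  U_deriv : ∀ t ∈ Ioo 0 T, HasDerivAt (fun τ => mulOp W (U τ)) (Y t) t
  Y_deriv : ∀ t ∈ Ioo 0 T, HasDerivAt Y
    (-(mulOp (fun η => W η * X η ^ 2 * k η ^ 2) (U t)) -
      mulOp (fun η => W η * X η ^ 2 * m η ^ 2) (fourierSuperposition hK h0 (U t))) t
  P₀_eq : ∀ᵐ η, Y 0 η = (W η * X η * m η : ℝ) * P₀ η
  Q₀_eq : ∀ᵐ η, U 0 η = (m η / k η : ℝ) * Q₀ η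

variable {S : ℕ → Set ℝ} {X k m W : ℝ → ℝ} {σ C₂ C₃ C₄ : ℝ} {γ : ℝ → ℝ} {K : ℝ≥0}
  {hK : LipschitzWith K γ} {h0 : γ 0 = 0} {T : ℝ} {U Y : ℝ → L2} {P₀ Q₀ : L2}

/-- The truncated kinetic amplitude, weighted by `α`. -/
def kinetic (S : ℕ → Set ℝ) (X k W : ℝ → ℝ) (Y : ℝ → L2) (α : ℝ → ℝ) (n : ℕ) (t : ℝ) : L2 :=
  mulOp ((S n).indicator fun η => α η / (W η * X η * k η)) (Y t)

/-- The truncated elastic amplitude, weighted by `α`. -/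
def elastic (S : ℕ → Set ℝ) (U : ℝ → L2) (α : ℝ → ℝ) (n : ℕ) (t : ℝ) : L2 :=
  mulOp ((S n).indicator α) (U t)

theorem Symbols.bddOn_div (hs : Symbols S X k m W σ C₂ C₃ C₄) {α : ℝ → ℝ} (hα : BddOn S α) :
    BddOn S fun η => α η / (W η * X η * k η) := by
  have := hα.mul ((hs.W_inv.mul hs.X_inv).mul hs.k_inv)
  simpa only [div_eq_mul_inv, mul_inv] using this

/-- The energy balance of the truncated quadratic energy with weight `α`: the linear part of the
equation does not contribute. -/
theorem hasDerivAt_energy (hs : Symbols S X k m W σ C₂ C₃ C₄)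
    (he : Evolution X k m W hK h0 T U Y P₀ Q₀) {α : ℝ → ℝ} (hα : BddOn S α) (n : ℕ) {t : ℝ}
    (ht : t ∈ Ioo 0 T) :
    HasDerivAt (fun τ => ‖kinetic S X k W Y α n τ‖ ^ 2 + ‖elastic S U α n τ‖ ^ 2)
      (-2 * ⟪kinetic S X k W Y α n t, mulOp ((S n).indicator fun η => α η * (X η * m η ^ 2 / k η))
        (fourierSuperposition hK h0 (U t))⟫_ℝ) t := by
  have hb1 := hs.bddOn_div hα
  have hb2 : BddOn S fun η => α η / W η := hα.div hs.W_inv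
  have hb3 : BddOn S fun η => α η * X η * k η := (hα.mul hs.X_bdd).mul hs.k_bdd
  have hb4 : BddOn S fun η => α η * (X η * m η ^ 2 / k η) := by
    refine hα.mul (BddOn.div (hs.X_bdd.mul ?_) hs.k_inv)
    simpa only [sq] using hs.m_bdd.mul hs.m_bdd
  have hq : HasDerivAt (elastic S U α n) (mulOp ((S n).indicator fun η => α η / W η) (Y t)) t := by
    have := (mulOp ((S n).indicator fun η => α η / W η)).hasFDerivAt.comp_hasDerivAt t
      (he.U_deriv t ht)
    refine this.congr_of_eventuallyEq (Eventually.of_forall fun τ => ?_)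
    refine (mulOp_indicator_mulOp hs.exh hb2 hs.W_bdd hα (fun η _ => ?_) _).symm
    have := (hs.W_pos η).ne'
    field_simp
  have hp := (mulOp ((S n).indicator fun η => α η / (W η * X η * k η))).hasFDerivAt.comp_hasDerivAt t
      (he.Y_deriv t ht)
  rw [map_sub, map_neg,
    mulOp_indicator_mulOp hs.exh hb1 hs.Wkk_bdd hb3 (fun η hη => by
      have h1 := (hs.W_pos η).ne'
      have h2 := (hs.X_pos n η hη).ne'
      have h3 := (hs.k_pos η).ne'
      field_simp),
    mulOp_indicator_mulOp hs.exh hb1 hs.Wmm_bdd hb4 (fun η hη => by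
      have h1 := (hs.W_pos η).ne'
      have h2 := (hs.X_pos n η hη).ne'
      have h3 := (hs.k_pos η).ne'
      field_simp)] at hp
  have hp' : HasDerivAt (kinetic S X k W Y α n) _ t := hp
  refine (hp'.norm_sq.fun_add hq.norm_sq).congr_deriv ?_
  have e : ⟪kinetic S X k W Y α n t, mulOp ((S n).indicator fun η => α η * X η * k η) (U t)⟫_ℝ =
      ⟪elastic S U α n t, mulOp ((S n).indicator fun η => α η / W η) (Y t)⟫_ℝ := by
    rw [real_inner_comm _ (elastic S U α n t)]
    refine inner_indicator_indicator hs.exh hb1 hb3 hb2 hα (fun η hη => ?_) _ _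
    have h1 := (hs.W_pos η).ne'
    have h2 := (hs.X_pos n η hη).ne'
    have h3 := (hs.k_pos η).ne'
    field_simp
  rw [inner_sub_right, inner_neg_right, e]
  ring

theorem continuousOn_kinetic (he : Evolution X k m W hK h0 T U Y P₀ Q₀) (α : ℝ → ℝ) (n : ℕ) :
    ContinuousOn (kinetic S X k W Y α n) (Icc 0 T) :=
  (mulOp _).continuous.comp_continuousOn he.Y_cont

theorem continuousOn_elastic (he : Evolution X k m W hK h0 T U Y P₀ Q₀) (α : ℝ → ℝ) (n : ℕ) :
    ContinuousOn (elastic S U α n) (Icc 0 T) :=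
  (mulOp _).continuous.comp_continuousOn he.U_cont

/-- The quadratic energy with weight `α` is controlled by its initial value and a bound for the
forcing. -/
theorem energy_le (hs : Symbols S X k m W σ C₂ C₃ C₄)
    (he : Evolution X k m W hK h0 T U Y P₀ Q₀) {α : ℝ → ℝ} (hα : BddOn S α) (n : ℕ) {f : ℝ → ℝ}
    (hf : ContinuousOn f (Icc 0 T)) (hf0 : ∀ t, 0 ≤ f t)
    (hfα : ∀ t ∈ Icc 0 T, ‖mulOp ((S n).indicator fun η => α η * (X η * m η ^ 2 / k η))
        (fourierSuperposition hK h0 (U t))‖ ^ 2 ≤ f t) {t : ℝ} (ht : t ∈ Icc 0 T) :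
    ‖kinetic S X k W Y α n t‖ ^ 2 + ‖elastic S U α n t‖ ^ 2 ≤
      Real.exp T * (‖kinetic S X k W Y α n 0‖ ^ 2 + ‖elastic S U α n 0‖ ^ 2 +
        ∫ τ in (0 : ℝ)..t, f τ) := by
  have h1 := le_exp_mul_of_deriv_le
    (E := fun τ => ‖kinetic S X k W Y α n τ‖ ^ 2 + ‖elastic S U α n τ‖ ^ 2)
    (((continuousOn_kinetic he α n).norm.pow 2).add ((continuousOn_elastic he α n).norm.pow 2))
    hf hf0 (fun t ht => hasDerivAt_energy hs he hα n ht) (fun t ht => ?_) ht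
  · refine h1.trans ?_
    have : 0 ≤ ∫ τ in (0 : ℝ)..t, f τ :=
      intervalIntegral.integral_nonneg ht.1 fun τ _ => hf0 τ
    have := ht.2
    gcongr
  · set p := kinetic S X k W Y α n t
    set z := mulOp ((S n).indicator fun η => α η * (X η * m η ^ 2 / k η))
      (fourierSuperposition hK h0 (U t))
    have h2 := hfα t (Ioo_subset_Icc_self ht)
    have h3 := abs_le.1 (abs_real_inner_le_norm p z)
    nlinarith [sq_nonneg (‖p‖ - ‖z‖), sq_nonneg ‖elastic S U α n t‖, h3.1]

/-- Every difference seminorm of `U t` is controlled by the same seminorm of the data, with a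
constant that does not depend on the step `h`. -/
theorem exists_diffSymbol_bound (hs : Symbols S X k m W σ C₂ C₃ C₄)
    (he : Evolution X k m W hK h0 T U Y P₀ Q₀) :
    ∃ A : ℝ, 0 ≤ A ∧ ∀ h, ∀ t ∈ Icc 0 T, ‖mulOp (diffSymbol h) (U t)‖ ^ 2 ≤
      A * (‖mulOp (diffSymbol h) (mulOp (fun η => m η / k η) P₀)‖ ^ 2 +
        ‖mulOp (diffSymbol h) (U 0)‖ ^ 2) := by
  set B : ℝ := Real.exp T * (C₂ ^ 2 * K ^ 2) with hB
  refine ⟨Real.exp T * Real.exp (B * T), by positivity, fun h t ht => ?_⟩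
  set Θ : L2 := mulOp (fun η => m η / k η) P₀ with hΘ
  set y := ‖mulOp (diffSymbol h) Θ‖ ^ 2 + ‖mulOp (diffSymbol h) (U 0)‖ ^ 2 with hy
  have hd := bddMeas_diffSymbol h
  have hα : BddOn S (diffSymbol h) := hd.bddOn
  set φ : ℝ → ℝ := fun t => ‖mulOp (diffSymbol h) (U t)‖ ^ 2 with hφ
  have hφc : ContinuousOn φ (Icc 0 T) :=
    ((mulOp (diffSymbol h)).continuous.comp_continuousOn he.U_cont).norm.pow 2
  have hφ0 : ∀ t, 0 ≤ φ t := fun t => by positivity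
  -- The energy with weight `diffSymbol h` is forced by the difference seminorm of the nonlinearity,
  -- which is bounded by the same energy since `X m² / k` is bounded.
  have key : ∀ t ∈ Icc 0 T, φ t ≤ Real.exp T * y + B * ∫ τ in (0 : ℝ)..t, φ τ := by
    intro t ht
    have hlim : Tendsto (fun n => ‖elastic S U (diffSymbol h) n t‖ ^ 2) atTop (𝓝 (φ t)) := by
      have := ((hs.exh.tendsto_cutoff (mulOp (diffSymbol h) (U t))).norm.pow 2)
      refine this.congr fun n => ?_
      rw [cutoff_mulOp hs.exh hd]
      rfl
    refine le_of_tendsto hlim (Eventually.of_forall fun n => ?_)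
    have h1 := energy_le hs he hα n (f := fun τ => C₂ ^ 2 * K ^ 2 * φ τ)
      (continuousOn_const.mul hφc) (fun t => by positivity) (fun τ hτ => ?_) ht
    · rw [intervalIntegral.integral_const_mul] at h1
      have h2 : ‖kinetic S X k W Y (diffSymbol h) n 0‖ ≤ ‖mulOp (diffSymbol h) Θ‖ := by
        have : kinetic S X k W Y (diffSymbol h) n 0 = cutoff (S n) (mulOp (diffSymbol h) Θ) := by
          rw [cutoff_mulOp hs.exh hd]
          refine mulOp_indicator_congr hs.exh (hs.bddOn_div hα) hα ?_
          filter_upwards [he.P₀_eq, mulOp_coe hs.mk_bdd P₀] with η h1 h2 hη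
          rw [h1, hΘ, h2, ← mul_assoc, ← mul_assoc]
          congr 1
          have h1 := (hs.W_pos η).ne'
          have h2 := (hs.X_pos n η hη).ne'
          have h3 := (hs.k_pos η).ne'
          norm_cast
          field_simp
        rw [this]
        exact norm_cutoff_le (hs.exh.meas n) _
      have h3 : ‖elastic S U (diffSymbol h) n 0‖ ≤ ‖mulOp (diffSymbol h) (U 0)‖ := by
        unfold elastic
        rw [← cutoff_mulOp hs.exh hd]
        exact norm_cutoff_le (hs.exh.meas n) _
      calc ‖elastic S U (diffSymbol h) n t‖ ^ 2 ≤ _ := le_add_of_nonneg_left (by positivity)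
        _ ≤ _ := h1
        _ ≤ Real.exp T * (y + C₂ ^ 2 * K ^ 2 * ∫ τ in (0 : ℝ)..t, φ τ) := by
            rw [hy]; gcongr
        _ = _ := by rw [hB]; ring
    · have h4 : ‖mulOp ((S n).indicator fun η => diffSymbol h η * (X η * m η ^ 2 / k η))
          (fourierSuperposition hK h0 (U τ))‖ ≤ C₂ * (K * ‖mulOp (diffSymbol h) (U τ)‖) := by
        refine (norm_mulOp_indicator_le hs.exh ?_ hd hs.C₂_nonneg (fun η hη => ?_) _).trans
          (mul_le_mul_of_nonneg_left (norm_diffSymbol_fourierSuperposition_le hK h0 h _)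
            hs.C₂_nonneg)
        · refine hα.mul (BddOn.div (hs.X_bdd.mul ?_) hs.k_inv)
          simpa only [sq] using hs.m_bdd.mul hs.m_bdd
        · rw [abs_mul, mul_comm]
          have := hs.X_pos n η hη
          have := hs.k_pos η
          rw [abs_of_nonneg (by positivity : 0 ≤ X η * m η ^ 2 / k η)]
          gcongr
          exact hs.le_C₂ n η hη
      calc _ ≤ (C₂ * (K * ‖mulOp (diffSymbol h) (U τ)‖)) ^ 2 := by gcongr
        _ = _ := by rw [hφ]; ring
  have h5 := le_mul_exp_of_le_integral (by positivity) hφc key ht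
  have hB0 : 0 ≤ B := by positivity
  have hy0 : 0 ≤ y := by positivity
  calc φ t ≤ Real.exp T * y * Real.exp (B * t) := h5
    _ ≤ Real.exp T * y * Real.exp (B * T) := by
        have := ht.2
        gcongr
    _ = _ := by ring

/-- An amplitude with the weight `m/k` has `σ` derivatives in `L²`. -/
theorem lintegral_rpow_mul_sq_le (hs : Symbols S X k m W σ C₂ C₃ C₄) {f f' : L2}
    (h : ∀ᵐ η, f η = (m η / k η : ℝ) * f' η) :
    ∫⁻ η, ENNReal.ofReal (|η| ^ (2 * σ)) * ‖f η‖ₑ ^ 2 ≤ ENNReal.ofReal (C₄ ^ 2 * ‖f'‖ ^ 2) := by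
  rw [ENNReal.ofReal_mul (by positivity), ofReal_norm_sq, ← lintegral_const_mul' _ _ (by simp)]
  apply lintegral_mono_ae
  filter_upwards [h] with η hη
  have h1 : 0 < m η / k η := div_pos (hs.m_pos η) (hs.k_pos η)
  rw [hη, enorm_mul, mul_pow, ← mul_assoc, ← ofReal_norm, Complex.norm_real, Real.norm_eq_abs,
    abs_of_pos h1, ← ENNReal.ofReal_pow h1.le, ← ENNReal.ofReal_mul (by positivity)]
  gcongr
  have h2 : |η| ^ (2 * σ) = (|η| ^ σ) ^ 2 := by
    rw [mul_comm, Real.rpow_mul (abs_nonneg η)]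
    norm_num
  rw [h2, ← mul_pow]
  have := hs.le_C₄ η
  gcongr

/-- The nonlinear term is bounded in the norm dual to the kinetic energy, for the solution as well
as for its truncations. -/
theorem exists_nonlinear_bound (hs : Symbols S X k m W σ C₂ C₃ C₄)
    (he : Evolution X k m W hK h0 T U Y P₀ Q₀) :
    ∃ M : ℝ, 0 ≤ M ∧ ∀ t ∈ Icc 0 T, ∀ n,
      ‖mulOp ((S n).indicator fun η => X η * m η) (fourierSuperposition hK h0 (U t))‖ ≤ M ∧
      ‖mulOp ((S n).indicator fun η => X η * m η)
        (fourierSuperposition hK h0 (cutoff (S n) (U t)))‖ ≤ M := by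
  obtain ⟨A, hA, hbd⟩ := exists_diffSymbol_bound hs he
  set Θ : L2 := mulOp (fun η => m η / k η) P₀ with hΘ
  set R : ℝ := C₃ ^ 2 * (K ^ 2 * A * (C₄ ^ 2 * ‖P₀‖ ^ 2 + C₄ ^ 2 * ‖Q₀‖ ^ 2)) with hR
  have hXm := hs.X_bdd.mul hs.m_bdd
  -- Multiplication by `X m` costs at most `σ` derivatives, which the nonlinearity inherits from `V`
  -- and which `V` inherits from the data.
  have key : ∀ V : L2, (∀ h, ‖mulOp (diffSymbol h) V‖ ^ 2 ≤ A * (‖mulOp (diffSymbol h) Θ‖ ^ 2 +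
      ‖mulOp (diffSymbol h) (U 0)‖ ^ 2)) → ∀ n, ‖mulOp ((S n).indicator fun η => X η * m η)
        (fourierSuperposition hK h0 V)‖ ≤ Real.sqrt R := by
    intro V hV n
    set N := fourierSuperposition hK h0 V
    have h1 : ∀ h, ∫⁻ η, ENNReal.ofReal (diffSymbol h η ^ 2) * ‖N η‖ₑ ^ 2 ≤
        ∫⁻ η, ENNReal.ofReal (diffSymbol h η ^ 2) *
          (ENNReal.ofReal (K ^ 2 * A) * (‖Θ η‖ₑ ^ 2 + ‖U 0 η‖ₑ ^ 2)) := by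
      intro h
      have hd := bddMeas_diffSymbol h
      have e : ∫⁻ η, ENNReal.ofReal (diffSymbol h η ^ 2) *
          (ENNReal.ofReal (K ^ 2 * A) * (‖Θ η‖ₑ ^ 2 + ‖U 0 η‖ₑ ^ 2)) =
          ENNReal.ofReal (K ^ 2 * A) * (ENNReal.ofReal (‖mulOp (diffSymbol h) Θ‖ ^ 2) +
            ENNReal.ofReal (‖mulOp (diffSymbol h) (U 0)‖ ^ 2)) := by
        rw [ofReal_norm_mulOp_sq hd, ofReal_norm_mulOp_sq hd, ← lintegral_add_left',
          ← lintegral_const_mul' _ _ ENNReal.ofReal_ne_top]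
        · congr 1; ext η; ring
        · refine AEMeasurable.mul ?_ ((Lp.aestronglyMeasurable Θ).enorm.pow_const 2)
          exact ((hd.1.pow_const 2).ennreal_ofReal).aemeasurable
      rw [e, ← ofReal_norm_mulOp_sq hd, ← ENNReal.ofReal_add (by positivity) (by positivity),
        ← ENNReal.ofReal_mul (by positivity)]
      apply ENNReal.ofReal_le_ofReal
      calc ‖mulOp (diffSymbol h) N‖ ^ 2 ≤ (K * ‖mulOp (diffSymbol h) V‖) ^ 2 := by
            gcongr; exact norm_diffSymbol_fourierSuperposition_le hK h0 h V
        _ = K ^ 2 * ‖mulOp (diffSymbol h) V‖ ^ 2 := by ring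
        _ ≤ K ^ 2 * (A * (‖mulOp (diffSymbol h) Θ‖ ^ 2 + ‖mulOp (diffSymbol h) (U 0)‖ ^ 2)) := by
            gcongr; exact hV h
        _ = _ := by ring
    have hmΘ : AEMeasurable (fun η => ‖Θ η‖ₑ ^ 2) :=
      (Lp.aestronglyMeasurable Θ).enorm.pow_const 2
    have hmU : AEMeasurable (fun η => ‖U 0 η‖ₑ ^ 2) :=
      (Lp.aestronglyMeasurable (U 0)).enorm.pow_const 2
    have h2 := lintegral_rpow_mul_le hs.σ_pos hs.σ_le
      ((Lp.aestronglyMeasurable N).enorm.pow_const 2) ((hmΘ.add hmU).const_mul _) h1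
    have h3 : ∫⁻ η, ENNReal.ofReal (|η| ^ (2 * σ)) *
        (ENNReal.ofReal (K ^ 2 * A) * (‖Θ η‖ₑ ^ 2 + ‖U 0 η‖ₑ ^ 2)) ≤
        ENNReal.ofReal (K ^ 2 * A * (C₄ ^ 2 * ‖P₀‖ ^ 2 + C₄ ^ 2 * ‖Q₀‖ ^ 2)) := by
      rw [ENNReal.ofReal_mul (p := K ^ 2 * A) (by positivity),
        ENNReal.ofReal_add (by positivity) (by positivity)]
      refine le_trans (le_of_eq ?_) (mul_le_mul_right (add_le_add
        (lintegral_rpow_mul_sq_le hs (mulOp_coe hs.mk_bdd P₀))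
        (lintegral_rpow_mul_sq_le hs he.Q₀_eq)) _)
      rw [← lintegral_add_left', ← lintegral_const_mul' _ _ ENNReal.ofReal_ne_top]
      · congr 1; ext η; ring
      · exact AEMeasurable.mul (Measurable.aemeasurable (by fun_prop)) hmΘ
    apply Real.le_sqrt_of_sq_le
    rw [← ENNReal.ofReal_le_ofReal_iff (by positivity), ofReal_norm_mulOp_sq (hXm.indicator hs.exh n),
      hR, ENNReal.ofReal_mul (by positivity)]
    refine le_trans ?_ (mul_le_mul_right (h2.trans h3) _)
    rw [← lintegral_const_mul' _ _ ENNReal.ofReal_ne_top]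
    apply lintegral_mono
    intro η
    by_cases hη : η ∈ S n
    · simp only [hη, indicator_of_mem]
      rw [← mul_assoc, ← ENNReal.ofReal_mul (by positivity)]
      gcongr
      have h2 : |η| ^ (2 * σ) = (|η| ^ σ) ^ 2 := by
        rw [mul_comm, Real.rpow_mul (abs_nonneg η)]
        norm_num
      rw [h2, ← mul_pow]
      have := hs.le_C₃ n η hη
      have := hs.X_pos n η hη
      have := hs.m_pos η
      gcongr
    · simp [hη]
  refine ⟨Real.sqrt R, Real.sqrt_nonneg R, fun t ht n =>
    ⟨key _ (fun h => hbd h t ht) n, key _ (fun h => le_trans ?_ (hbd h t ht)) n⟩⟩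
  rw [mulOp_cutoff hs.exh (bddMeas_diffSymbol h)]
  gcongr
  exact norm_cutoff_le (hs.exh.meas n) _

end Evolution

/-! ### Conservation of energy on the Fourier side -/

section Conservation

variable {S : ℕ → Set ℝ} {X k m W : ℝ → ℝ} {σ C₂ C₃ C₄ : ℝ} {γ : ℝ → ℝ} {K : ℝ≥0}
  {hK : LipschitzWith K γ} {h0 : γ 0 = 0} {T : ℝ} {U Y : ℝ → L2} {P₀ Q₀ : L2}

/-- For the weight `k/m` of the energy, the kinetic amplitude is the one of `B^(-1/2) Λ⁻¹ u_t`. -/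
theorem kinetic_eq_cutoff (hs : Symbols S X k m W σ C₂ C₃ C₄) {t : ℝ} {P : L2}
    (hP : ∀ᵐ η, Y t η = (W η * X η * m η : ℝ) * P η) (n : ℕ) :
    kinetic S X k W Y (fun η => k η / m η) n t = cutoff (S n) P := by
  refine mulOp_indicator_congr hs.exh (hs.bddOn_div (hs.k_bdd.div hs.m_inv))
    (bddMeas_const 1).bddOn ?_
  filter_upwards [hP] with η h1 hη
  rw [h1, ← mul_assoc]
  congr 1
  have h1 := (hs.W_pos η).ne'
  have h2 := (hs.X_pos n η hη).ne'
  have h3 := (hs.k_pos η).ne'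
  have h4 := (hs.m_pos η).ne'
  norm_cast
  field_simp

/-- For the weight `k/m` of the energy, the elastic amplitude is the one of `B^(-1/2) K u`. -/
theorem elastic_eq_cutoff (hs : Symbols S X k m W σ C₂ C₃ C₄) {t : ℝ} {Q : L2}
    (hQ : ∀ᵐ η, U t η = (m η / k η : ℝ) * Q η) (n : ℕ) :
    elastic S U (fun η => k η / m η) n t = cutoff (S n) Q := by
  refine mulOp_indicator_congr hs.exh (hs.k_bdd.div hs.m_inv) (bddMeas_const 1).bddOn ?_
  filter_upwards [hQ] with η h1 hη
  rw [h1, ← mul_assoc]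
  congr 1
  have h3 := (hs.k_pos η).ne'
  have h4 := (hs.m_pos η).ne'
  norm_cast
  field_simp

/-- The quadratic part of the energy is bounded, uniformly in time and in the truncation. -/
theorem exists_energy_bound (hs : Symbols S X k m W σ C₂ C₃ C₄)
    (he : Evolution X k m W hK h0 T U Y P₀ Q₀) :
    ∃ B : ℝ, ∀ t ∈ Icc 0 T, ∀ n,
      ‖kinetic S X k W Y (fun η => k η / m η) n t‖ ^ 2 +
        ‖elastic S U (fun η => k η / m η) n t‖ ^ 2 ≤ B := by
  obtain ⟨M, hM0, hM⟩ := exists_nonlinear_bound hs he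
  refine ⟨Real.exp T * (‖P₀‖ ^ 2 + ‖Q₀‖ ^ 2 + T * M ^ 2), fun t ht n => ?_⟩
  have h1 := energy_le hs he (hs.k_bdd.div hs.m_inv) n (f := fun _ => M ^ 2) continuousOn_const
    (fun _ => by positivity) (fun t ht => ?_) ht
  · refine h1.trans ?_
    rw [kinetic_eq_cutoff hs he.P₀_eq, elastic_eq_cutoff hs he.Q₀_eq,
      intervalIntegral.integral_const, smul_eq_mul, sub_zero]
    have := norm_cutoff_le (hs.exh.meas n) P₀
    have := norm_cutoff_le (hs.exh.meas n) Q₀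
    have := ht.2
    gcongr
  · have h2 := (hM t ht n).1
    have e : (S n).indicator (fun η => k η / m η * (X η * m η ^ 2 / k η)) =
        (S n).indicator fun η => X η * m η := by
      congr 1
      funext η
      have h3 := (hs.k_pos η).ne'
      have h4 := (hs.m_pos η).ne'
      field_simp
    rw [e]
    gcongr

/-- The energy is finite at all times. -/
theorem exists_amplitudes (hs : Symbols S X k m W σ C₂ C₃ C₄)
    (he : Evolution X k m W hK h0 T U Y P₀ Q₀) {t : ℝ} (ht : t ∈ Icc 0 T) :
    ∃ P Q : L2, (∀ᵐ η, Y t η = (W η * X η * m η : ℝ) * P η) ∧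
      ∀ᵐ η, U t η = (m η / k η : ℝ) * Q η := by
  obtain ⟨B, hB⟩ := exists_energy_bound hs he
  have hα := hs.k_bdd.div hs.m_inv
  have hP : MemLp (fun η => ((k η / m η / (W η * X η * k η) : ℝ) : ℂ) * Y t η) 2 volume := by
    refine hs.exh.memLp (f := fun n => kinetic S X k W Y (fun η => k η / m η) n t) (B := B) ?_ ?_ ?_
    · exact (Complex.measurable_ofReal.comp (hs.bddOn_div hα).meas).aestronglyMeasurable.mul
        (Lp.aestronglyMeasurable _)
    · intro n
      filter_upwards [mulOp_coe ((hs.bddOn_div hα).indicator hs.exh n) (Y t)] with η h1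
      unfold kinetic
      rw [h1]
      by_cases hη : η ∈ S n <;> simp [hη]
    · exact fun n => (le_add_of_nonneg_right (by positivity)).trans (hB t ht n)
  have hQ : MemLp (fun η => ((k η / m η : ℝ) : ℂ) * U t η) 2 volume := by
    refine hs.exh.memLp (f := fun n => elastic S U (fun η => k η / m η) n t) (B := B) ?_ ?_ ?_
    · exact (Complex.measurable_ofReal.comp hα.meas).aestronglyMeasurable.mul
        (Lp.aestronglyMeasurable _)
    · intro n
      filter_upwards [mulOp_coe (hα.indicator hs.exh n) (U t)] with η h1
      unfold elastic
      rw [h1]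
      by_cases hη : η ∈ S n <;> simp [hη]
    · exact fun n => (le_add_of_nonneg_left (by positivity)).trans (hB t ht n)
  refine ⟨hP.toLp _, hQ.toLp _, ?_, ?_⟩
  · filter_upwards [hP.coeFn_toLp, hs.exh.ae_mem] with η h1 ⟨n, hη⟩
    rw [h1, ← mul_assoc]
    have h1 := (hs.W_pos η).ne'
    have h2 := (hs.X_pos n η hη).ne'
    have h3 := (hs.k_pos η).ne'
    have h4 := (hs.m_pos η).ne'
    have : W η * X η * m η * (k η / m η / (W η * X η * k η)) = 1 := by field_simp
    rw [← Complex.ofReal_mul, this, Complex.ofReal_one, one_mul]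
  · filter_upwards [hQ.coeFn_toLp] with η h1
    rw [h1, ← mul_assoc]
    have h3 := (hs.k_pos η).ne'
    have h4 := (hs.m_pos η).ne'
    have : m η / k η * (k η / m η) = 1 := by field_simp
    rw [← Complex.ofReal_mul, this, Complex.ofReal_one, one_mul]

/-- The derivative of the truncated total energy is a commutator of the truncation and the
nonlinearity. -/
theorem hasDerivAt_total_energy (hs : Symbols S X k m W σ C₂ C₃ C₄)
    (he : Evolution X k m W hK h0 T U Y P₀ Q₀) (n : ℕ) {t : ℝ} (ht : t ∈ Ioo 0 T) :
    HasDerivAt (fun τ => ‖kinetic S X k W Y (fun η => k η / m η) n τ‖ ^ 2 +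
        ‖elastic S U (fun η => k η / m η) n τ‖ ^ 2 + 2 * potential γ (cutoff (S n) (U τ)))
      (2 * ⟪kinetic S X k W Y (fun η => k η / m η) n t, mulOp ((S n).indicator fun η => X η * m η)
        (fourierSuperposition hK h0 (cutoff (S n) (U t)) -
          fourierSuperposition hK h0 (U t))⟫_ℝ) t := by
  have hα := hs.k_bdd.div hs.m_inv
  have hXm := hs.X_bdd.mul hs.m_bdd
  have h1 := hasDerivAt_energy hs he hα n ht
  have e : (S n).indicator (fun η => k η / m η * (X η * m η ^ 2 / k η)) =
      (S n).indicator fun η => X η * m η := by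
    congr 1
    funext η
    have h3 := (hs.k_pos η).ne'
    have h4 := (hs.m_pos η).ne'
    field_simp
  rw [e] at h1
  have h2 : HasDerivAt (fun τ => cutoff (S n) (U τ))
      (mulOp ((S n).indicator fun η => (W η)⁻¹) (Y t)) t := by
    have := (mulOp ((S n).indicator fun η => (W η)⁻¹)).hasFDerivAt.comp_hasDerivAt t
      (he.U_deriv t ht)
    refine this.congr_of_eventuallyEq (Eventually.of_forall fun τ => ?_)
    refine (mulOp_indicator_mulOp hs.exh hs.W_inv hs.W_bdd (bddMeas_const 1).bddOn
      (fun η _ => ?_) _).symm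
    exact inv_mul_cancel₀ (hs.W_pos η).ne'
  have h3 := (hasFDerivAt_potential hK h0 (cutoff (S n) (U t))).comp_hasDerivAt t h2
  refine (h1.fun_add (h3.const_mul 2)).congr_deriv ?_
  have e2 : ⟪fourierSuperposition hK h0 (cutoff (S n) (U t)),
      mulOp ((S n).indicator fun η => (W η)⁻¹) (Y t)⟫_ℝ =
      ⟪kinetic S X k W Y (fun η => k η / m η) n t, mulOp ((S n).indicator fun η => X η * m η)
        (fourierSuperposition hK h0 (cutoff (S n) (U t)))⟫_ℝ := by
    rw [real_inner_comm]
    have e3 : ∀ f : L2, ⟪mulOp ((S n).indicator fun η => (W η)⁻¹) (Y t), f⟫_ℝ =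
        ⟪mulOp ((S n).indicator fun η => (W η)⁻¹) (Y t),
          mulOp ((S n).indicator fun _ => (1 : ℝ)) f⟫_ℝ := by
      intro f
      rw [← inner_mulOp_left (bddMeas_indicator_one (hs.exh.meas n)),
        mulOp_mulOp (bddMeas_indicator_one (hs.exh.meas n)) (hs.W_inv.indicator hs.exh n)]
      congr 3
      funext η
      by_cases hη : η ∈ S n <;> simp [hη]
    rw [e3]
    refine inner_indicator_indicator hs.exh hs.W_inv (bddMeas_const 1).bddOn (hs.bddOn_div hα) hXm
      (fun η hη => ?_) _ _
    have h1 := (hs.W_pos η).ne'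
    have h2 := (hs.X_pos n η hη).ne'
    have h3 := (hs.k_pos η).ne'
    have h4 := (hs.m_pos η).ne'
    field_simp
  rw [innerSL_apply_apply, e2, map_sub, inner_sub_right]
  ring

/-- Conservation of energy for the equation on the Fourier side. -/
theorem Evolution.energy_eq (hs : Symbols S X k m W σ C₂ C₃ C₄)
    (he : Evolution X k m W hK h0 T U Y P₀ Q₀) :
    ∃ P Q : L2, (∀ᵐ η, Y T η = (W η * X η * m η : ℝ) * P η) ∧
      (∀ᵐ η, U T η = (m η / k η : ℝ) * Q η) ∧
      ‖P‖ ^ 2 + ‖Q‖ ^ 2 + 2 * potential γ (U T) =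
        ‖P₀‖ ^ 2 + ‖Q₀‖ ^ 2 + 2 * potential γ (U 0) := by
  have hT := he.T_nonneg
  have hXm := hs.X_bdd.mul hs.m_bdd
  obtain ⟨M, hM0, hM⟩ := exists_nonlinear_bound hs he
  obtain ⟨B, hB⟩ := exists_energy_bound hs he
  obtain ⟨P, Q, hP, hQ⟩ := exists_amplitudes hs he (right_mem_Icc.2 hT)
  refine ⟨P, Q, hP, hQ, ?_⟩
  set N := fourierSuperposition hK h0
  have hN : Continuous N := continuous_fourierSuperposition hK h0
  set E : ℕ → ℝ → ℝ := fun n τ => ‖kinetic S X k W Y (fun η => k η / m η) n τ‖ ^ 2 +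
    ‖elastic S U (fun η => k η / m η) n τ‖ ^ 2 + 2 * potential γ (cutoff (S n) (U τ)) with hE
  set D : ℕ → ℝ → ℝ := fun n t => 2 * ⟪kinetic S X k W Y (fun η => k η / m η) n t,
    mulOp ((S n).indicator fun η => X η * m η) (N (cutoff (S n) (U t)) - N (U t))⟫_ℝ with hD
  have hcut : ∀ n, ContinuousOn (fun τ => cutoff (S n) (U τ)) (Icc 0 T) := fun n =>
    (cutoff (S n)).continuous.comp_continuousOn he.U_cont
  have hEc : ∀ n, ContinuousOn (E n) (Icc 0 T) := fun n =>
    (((continuousOn_kinetic he _ n).norm.pow 2).add ((continuousOn_elastic he _ n).norm.pow 2)).add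
      (continuousOn_const.mul ((continuous_potential hK h0).comp_continuousOn (hcut n)))
  have hDc : ∀ n, ContinuousOn (D n) (Icc 0 T) := fun n =>
    continuousOn_const.mul ((continuousOn_kinetic he _ n).inner
      ((mulOp _).continuous.comp_continuousOn
        ((hN.comp_continuousOn (hcut n)).sub (hN.comp_continuousOn he.U_cont))))
  have hFTC : ∀ n, ∫ τ in (0 : ℝ)..T, D n τ = E n T - E n 0 := fun n =>
    intervalIntegral.integral_eq_sub_of_hasDerivAt_of_le hT (hEc n)
      (fun t ht => hasDerivAt_total_energy hs he n ht)
      (by rw [← uIcc_of_le hT] at hDc; exact (hDc n).intervalIntegrable)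
  have hz : ∀ t ∈ Icc 0 T, ∀ n, ‖mulOp ((S n).indicator fun η => X η * m η)
      (N (cutoff (S n) (U t)) - N (U t))‖ ≤ 2 * M := by
    intro t ht n
    rw [map_sub]
    refine (norm_sub_le _ _).trans ?_
    have := hM t ht n
    linarith [this.1, this.2]
  -- The commutator tends to zero in `L²`, but only stays bounded after multiplication by `X m`; this
  -- suffices against the fixed amplitude `P`, whose truncations the kinetic amplitudes are.
  have hDlim : ∀ t ∈ Icc 0 T, Tendsto (fun n => D n t) atTop (𝓝 0) := by
    intro t ht
    obtain ⟨P, Q, hP, -⟩ := exists_amplitudes hs he ht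
    have hw : Tendsto (fun n => N (cutoff (S n) (U t)) - N (U t)) atTop (𝓝 0) := by
      have := ((hN.tendsto (U t)).comp (hs.exh.tendsto_cutoff (U t))).sub_const (N (U t))
      simpa using this
    have h1 := (tendsto_inner_truncated hs.exh hXm hw (hz t ht) P).const_mul 2
    rw [mul_zero] at h1
    refine h1.congr fun n => ?_
    simp only [hD]
    rw [kinetic_eq_cutoff hs hP, cutoff, inner_mulOp_left (bddMeas_indicator_one (hs.exh.meas n)),
      mulOp_mulOp (bddMeas_indicator_one (hs.exh.meas n)) (hXm.indicator hs.exh n)]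
    congr 4
    funext η
    by_cases hη : η ∈ S n <;> simp [hη]
  have hDbd : ∀ n, ∀ t ∈ Icc 0 T, ‖D n t‖ ≤ 2 * (Real.sqrt B * (2 * M)) := by
    intro n t ht
    simp only [hD]
    rw [norm_mul, Real.norm_eq_abs, abs_of_pos (by norm_num : (0 : ℝ) < 2)]
    refine mul_le_mul_of_nonneg_left ((norm_inner_le_norm _ _).trans
      (mul_le_mul ?_ (hz t ht n) (norm_nonneg _) (Real.sqrt_nonneg _))) (by norm_num)
    exact Real.le_sqrt_of_sq_le ((le_add_of_nonneg_right (by positivity)).trans (hB t ht n))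
  have hint : Tendsto (fun n => ∫ τ in (0 : ℝ)..T, D n τ) atTop (𝓝 (∫ _ in (0 : ℝ)..T, (0 : ℝ))) := by
    refine intervalIntegral.tendsto_integral_filter_of_dominated_convergence
      (fun _ => 2 * (Real.sqrt B * (2 * M))) (Eventually.of_forall fun n => ?_)
      (Eventually.of_forall fun n => ae_of_all _ fun t ht => ?_) (by simp)
      (ae_of_all _ fun t ht => ?_)
    · rw [uIoc_of_le hT]
      exact ((hDc n).mono Ioc_subset_Icc_self).aestronglyMeasurable measurableSet_Ioc
    · rw [uIoc_of_le hT] at ht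
      exact hDbd n t (Ioc_subset_Icc_self ht)
    · rw [uIoc_of_le hT] at ht
      exact hDlim t (Ioc_subset_Icc_self ht)
  rw [intervalIntegral.integral_zero] at hint
  have hElim : ∀ t, ∀ P Q : L2, (∀ᵐ η, Y t η = (W η * X η * m η : ℝ) * P η) →
      (∀ᵐ η, U t η = (m η / k η : ℝ) * Q η) → Tendsto (fun n => E n t) atTop
        (𝓝 (‖P‖ ^ 2 + ‖Q‖ ^ 2 + 2 * potential γ (U t))) := by
    intro t P Q hP hQ
    simp only [hE]
    simp_rw [kinetic_eq_cutoff hs hP, elastic_eq_cutoff hs hQ]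
    exact (((hs.exh.tendsto_cutoff P).norm.pow 2).add ((hs.exh.tendsto_cutoff Q).norm.pow 2)).add
      ((((continuous_potential hK h0).tendsto (U t)).comp (hs.exh.tendsto_cutoff (U t))).const_mul 2)
  have h1 := (hElim T P Q hP hQ).sub (hElim 0 P₀ Q₀ he.P₀_eq he.Q₀_eq)
  simp_rw [hFTC] at hint
  exact sub_eq_zero.1 (tendsto_nhds_unique h1 hint)

end Conservation

/-! ### Tempered distributions with a density -/

namespace HasDensity

variable {f : 𝓢'(ℝ, ℂ)} {F F' : ℝ → ℂ}

theorem locallyIntegrable (h : HasDensity f F) : LocallyIntegrable F := by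
  rw [locallyIntegrable_iff]
  intro k hk
  obtain ⟨R, hR0, hR⟩ := hk.isBounded.subset_closedBall_lt 0 (0 : ℝ)
  let χ : ContDiffBump (0 : ℝ) := ⟨R, R + 1, hR0, by linarith⟩
  have h1 : HasCompactSupport (Complex.ofRealCLM ∘ χ) := χ.hasCompactSupport.comp_left rfl
  have h2 : ContDiff ℝ (⊤ : ℕ∞) (Complex.ofRealCLM ∘ χ) :=
    Complex.ofRealCLM.contDiff.comp χ.contDiff
  have h3 := (h (h1.toSchwartzMap h2)).1.integrableOn (s := k)
  refine h3.congr_fun (fun x hx => ?_) hk.measurableSet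
  have : χ x = 1 := χ.one_of_mem_closedBall (hR hx)
  simp [this]

/-- The density of a distribution is unique up to null sets. -/
theorem ae_eq (h : HasDensity f F) (h' : HasDensity f F') : F =ᵐ[volume] F' := by
  apply ae_eq_of_integral_contDiff_smul_eq h.locallyIntegrable h'.locallyIntegrable
  intro g hg hgc
  have h1 : HasCompactSupport (Complex.ofRealCLM ∘ g) := hgc.comp_left rfl
  have h2 : ContDiff ℝ (⊤ : ℕ∞) (Complex.ofRealCLM ∘ g) := Complex.ofRealCLM.contDiff.comp hg
  have h3 := (h (h1.toSchwartzMap h2)).2.symm.trans (h' (h1.toSchwartzMap h2)).2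
  simpa using h3

theorem congr_ae (h : HasDensity f F) (hF : F =ᵐ[volume] F') : HasDensity f F' := by
  intro θ
  have e : (fun x => θ x * F x) =ᵐ[volume] fun x => θ x * F' x := by
    filter_upwards [hF] with x hx
    rw [hx]
  exact ⟨(h θ).1.congr e, (h θ).2.trans (integral_congr_ae e)⟩

theorem of_L2 (f : L2) : HasDensity (f : 𝓢'(ℝ, ℂ)) f := by
  intro θ
  refine ⟨(θ.memLp 2 volume).integrable_mul (Lp.memLp f), ?_⟩
  rw [Lp.toTemperedDistribution_apply]
  simp

theorem smulLeft (h : HasDensity f F) {a : ℝ → ℂ} (ha : a.HasTemperateGrowth) :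
    HasDensity (TemperedDistribution.smulLeftCLM ℂ a f) fun η => a η * F η := by
  intro θ
  have h1 := h (SchwartzMap.smulLeftCLM ℂ a θ)
  have e : (fun x => SchwartzMap.smulLeftCLM ℂ a θ x * F x) = fun x => θ x * (a x * F x) := by
    funext x
    rw [SchwartzMap.smulLeftCLM_apply_apply ha, smul_eq_mul]
    ring
  rw [e] at h1
  exact h1

theorem smul (h : HasDensity f F) (c : ℂ) : HasDensity (c • f) fun η => c * F η := by
  intro θ
  have e : (fun x => θ x * (c * F x)) = fun x => c * (θ x * F x) := by funext x; ring
  rw [e]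
  refine ⟨(h θ).1.const_mul c, ?_⟩
  rw [integral_const_mul, ← (h θ).2]
  rfl

theorem fourier_dxx (h : HasDensity (𝓕 f) F) :
    HasDensity (𝓕 (dxx f)) fun η => -((2 * Real.pi * η : ℝ) : ℂ) ^ 2 * F η := by
  unfold dxx
  have ha : Function.HasTemperateGrowth (fun x : ℝ => ((inner ℝ x 1 : ℝ) : ℂ)) := by fun_prop
  rw [TemperedDistribution.fourier_lineDerivOp_eq, TemperedDistribution.fourier_lineDerivOp_eq]
  have h1 := (((h.smulLeft ha).smul (2 * Real.pi * Complex.I)).smulLeft ha).smul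
    (2 * Real.pi * Complex.I)
  refine h1.congr_ae (ae_of_all _ fun η => ?_)
  simp only [RCLike.inner_apply, conj_trivial, one_mul]
  push_cast
  ring_nf
  rw [Complex.I_sq]
  ring

end HasDensity

theorem hasTemperateGrowth_bracket (σ : ℝ) :
    Function.HasTemperateGrowth (fun x : ℝ => (((1 + x ^ 2) ^ (σ / 2) : ℝ) : ℂ)) := by
  have h : Function.HasTemperateGrowth (fun x : ℝ => (((1 + ‖x‖ ^ 2) ^ (σ / 2) : ℝ) : ℂ)) := by
    fun_prop
  simpa using h

theorem hasDensity_fourier_of_besselPotential {σ : ℝ} {f : 𝓢'(ℝ, ℂ)} {w : L2}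
    (h : TemperedDistribution.besselPotential ℝ ℂ σ f = (w : 𝓢'(ℝ, ℂ))) :
    HasDensity (𝓕 f) fun η => (((1 + η ^ 2) ^ (-σ / 2) : ℝ) : ℂ) * (𝓕 w : L2) η := by
  have h1 := (TemperedDistribution.besselPotential_neg_apply_eq_iff σ (w : 𝓢'(ℝ, ℂ)) f).2 h
  rw [← h1, TemperedDistribution.fourier_besselPotential_eq_smulLeftCLM_fourier_apply,
    Lp.fourier_toTemperedDistribution_eq]
  have h2 := (HasDensity.of_L2 (𝓕 w)).smulLeft (hasTemperateGrowth_bracket (-σ))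
  simpa using h2

theorem L2_ext {f g : L2} (h : ∀ θ : 𝓢(ℝ, ℂ), ∫ x, θ x * f x = ∫ x, θ x * g x) : f = g := by
  apply Lp.ext
  refine (HasDensity.of_L2 f).ae_eq fun θ => ⟨(HasDensity.of_L2 g θ).1, ?_⟩
  rw [← h, (HasDensity.of_L2 f θ).2]

/-- The integral against a Schwartz function as a continuous linear functional on `L²`. -/
def pairing (θ : 𝓢(ℝ, ℂ)) : L2 →L[ℝ] ℂ :=
  ((PointwiseConvergenceCLM.evalCLM (RingHom.id ℂ) ℂ θ).comp
    (Lp.toTemperedDistributionCLM ℂ (volume : Measure ℝ) 2)).restrictScalars ℝ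

theorem pairing_apply (θ : 𝓢(ℝ, ℂ)) (f : L2) : pairing θ f = ∫ x, θ x * f x :=
  (HasDensity.of_L2 f θ).2

/-- A curve in `L²` that is differentiable when tested against Schwartz functions, with a continuous
derivative, is differentiable in norm. -/
theorem hasDerivAt_of_pairing {Y Z : ℝ → L2} {I : Set ℝ} (hI : IsOpen I)
    (hZ : ContinuousOn Z I)
    (h : ∀ θ : 𝓢(ℝ, ℂ), ∀ t ∈ I, HasDerivAt (fun τ => ∫ x, θ x * Y τ x) (∫ x, θ x * Z t x) t)
    {t : ℝ} (ht : t ∈ I) : HasDerivAt Y (Z t) t := by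
  obtain ⟨ε, hε, hball⟩ := Metric.isOpen_iff.1 hI t ht
  have hsub : ∀ τ ∈ Metric.ball t ε, uIcc t τ ⊆ I := fun τ hτ =>
    (convex_ball t ε).ordConnected.uIcc_subset (Metric.mem_ball_self hε) hτ |>.trans hball
  have hint : ∀ τ ∈ Metric.ball t ε, Y τ = Y t + ∫ r in t..τ, Z r := by
    intro τ hτ
    have hc := hZ.mono (hsub τ hτ)
    apply L2_ext
    intro θ
    rw [← pairing_apply, ← pairing_apply, map_add,
      ← ContinuousLinearMap.intervalIntegral_comp_comm _ hc.intervalIntegrable,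
      intervalIntegral.integral_eq_sub_of_hasDerivAt (f := fun τ => pairing θ (Y τ))]
    · simp
    · intro r hr
      simp_rw [pairing_apply]
      exact h θ r (hsub τ hτ hr)
    · exact ((pairing θ).continuous.comp_continuousOn hc).intervalIntegrable
  have hd : HasDerivAt (fun τ => Y t + ∫ r in t..τ, Z r) (Z t) t := by
    refine HasDerivAt.const_add _ (intervalIntegral.integral_hasDerivAt_right (by simp) ?_
      (hZ.continuousAt (hI.mem_nhds ht)))
    exact hZ.stronglyMeasurableAtFilter hI t ht
  refine hd.congr_of_eventuallyEq ?_
  filter_upwards [Metric.ball_mem_nhds t hε] with τ hτ using hint τ hτ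

/-- An `L²` function is bounded by the `L¹` norm of its Fourier transform. -/
theorem ae_norm_le_integral_norm_fourier {f : L2} (h : Integrable (𝓕 f : L2)) :
    ∀ᵐ x, ‖f x‖ ≤ ∫ η, ‖(𝓕 f : L2) η‖ := by
  have hbd : ∀ x, ‖𝓕⁻ ((𝓕 f : L2) : ℝ → ℂ) x‖ ≤ ∫ η, ‖(𝓕 f : L2) η‖ := fun x => by
    rw [Real.fourierInv_eq]
    refine (norm_integral_le_integral_norm _).trans (le_of_eq ?_)
    simp_rw [Circle.norm_smul]
  have hd : HasDensity (f : 𝓢'(ℝ, ℂ)) (𝓕⁻ ((𝓕 f : L2) : ℝ → ℂ)) := by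
    have hcont : Continuous (𝓕⁻ ((𝓕 f : L2) : ℝ → ℂ)) :=
      VectorFourier.fourierIntegral_continuous Real.continuous_fourierChar
        (L := -(innerₗ ℝ)) (by fun_prop) h
    intro θ
    constructor
    · exact θ.integrable.mul_bdd hcont.aestronglyMeasurable (ae_of_all _ hbd)
    · have e1 : (f : 𝓢'(ℝ, ℂ)) = 𝓕⁻ ((𝓕 f : L2) : 𝓢'(ℝ, ℂ)) := by
        rw [Lp.fourierInv_toTemperedDistribution_eq, FourierTransform.fourierInv_fourier_eq]
      rw [e1, TemperedDistribution.fourierInv_apply, (HasDensity.of_L2 (𝓕 f) _).2]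
      have := VectorFourier.integral_fourierIntegral_smul_eq_flip (L := -(innerₗ ℝ))
        (μ := volume) (ν := volume) Real.continuous_fourierChar (by fun_prop) θ.integrable h
      rw [show (-(innerₗ ℝ) : ℝ →ₗ[ℝ] ℝ →ₗ[ℝ] ℝ).flip = -(innerₗ ℝ) by
        ext; simp] at this
      rw [SchwartzMap.fourierInv_coe]
      exact this
  filter_upwards [(HasDensity.of_L2 f).ae_eq hd] with x hx
  rw [hx]
  exact hbd x

/-! ### The symbols of the equation -/

/-- The weight `(1 + η²)^(σ/2)`. -/
def bracket (σ η : ℝ) : ℝ := (1 + η ^ 2) ^ (σ / 2)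

theorem bracket_pos (σ η : ℝ) : 0 < bracket σ η := Real.rpow_pos_of_pos (by positivity) _

theorem bracket_mul_bracket (σ τ η : ℝ) : bracket σ η * bracket τ η = bracket (σ + τ) η := by
  unfold bracket
  rw [← Real.rpow_add (by positivity)]
  congr 1
  ring

theorem bracket_le_one {σ : ℝ} (hσ : σ ≤ 0) (η : ℝ) : bracket σ η ≤ 1 :=
  Real.rpow_le_one_of_one_le_of_nonpos (by nlinarith [sq_nonneg η]) (by linarith)

theorem measurable_bracket (σ : ℝ) : Measurable (bracket σ) := by unfold bracket; fun_prop

theorem bddMeas_bracket {σ : ℝ} (hσ : σ ≤ 0) : BddMeas (bracket σ) :=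
  ⟨measurable_bracket σ, 1, fun η => by
    rw [abs_of_pos (bracket_pos σ η)]; exact bracket_le_one hσ η⟩

theorem abs_le_bracket_one (ξ : ℝ) : |ξ| ≤ bracket 1 ξ := by
  unfold bracket
  rw [← Real.sqrt_eq_rpow]
  exact Real.abs_le_sqrt (by linarith)

theorem abs_rpow_le_bracket {σ : ℝ} (hσ : 0 ≤ σ) (ξ : ℝ) : |ξ| ^ σ ≤ bracket σ ξ := by
  refine (Real.rpow_le_rpow (abs_nonneg _) (abs_le_bracket_one ξ) hσ).trans (le_of_eq ?_)
  unfold bracket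
  rw [← Real.rpow_mul (by positivity)]
  congr 1
  ring

section Bounds

variable {ρ r c₁ c₃ k m ξ : ℝ}

theorem div_le_bracket (hc₁ : 0 < c₁) (hm0 : 0 < m) (hk : c₁ * bracket (ρ / 2) ξ ≤ k)
    (hm : m ≤ c₃ * bracket (-r / 2) ξ) : m / k ≤ c₃ / c₁ * bracket (-r / 2 - ρ / 2) ξ := by
  have hb := bracket_pos (ρ / 2) ξ
  calc m / k ≤ c₃ * bracket (-r / 2) ξ / (c₁ * bracket (ρ / 2) ξ) := by gcongr; exact hm0.le.trans hm
    _ = _ := by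
      have : bracket (-r / 2) ξ = bracket (-r / 2 - ρ / 2) ξ * bracket (ρ / 2) ξ := by
        rw [bracket_mul_bracket]; congr 1; ring
      rw [this]
      field_simp

theorem abs_mul_sq_div_le (hρr : 1 ≤ ρ / 2 + r) (hc₁ : 0 < c₁) (hc₃ : 0 < c₃) (hm0 : 0 < m)
    (hk0 : 0 < k) (hk : c₁ * bracket (ρ / 2) ξ ≤ k) (hm : m ≤ c₃ * bracket (-r / 2) ξ) :
    |ξ| * m ^ 2 / k ≤ c₃ ^ 2 / c₁ := by
  have h1 := div_le_bracket hc₁ hm0 hk hm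
  have h2 := abs_le_bracket_one ξ
  have h3 := bracket_pos (-r / 2) ξ
  have h4 := bracket_pos (-r / 2 - ρ / 2) ξ
  have h5 := bracket_pos 1 ξ
  calc |ξ| * m ^ 2 / k = |ξ| * m * (m / k) := by ring
    _ ≤ bracket 1 ξ * (c₃ * bracket (-r / 2) ξ) * (c₃ / c₁ * bracket (-r / 2 - ρ / 2) ξ) := by
        gcongr
    _ = c₃ ^ 2 / c₁ * (bracket 1 ξ * bracket (-r / 2) ξ * bracket (-r / 2 - ρ / 2) ξ) := by ring
    _ ≤ c₃ ^ 2 / c₁ * 1 := by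
        gcongr
        rw [bracket_mul_bracket, bracket_mul_bracket]
        exact bracket_le_one (by linarith) ξ
    _ = _ := mul_one _

theorem abs_mul_le_rpow (hr : 0 ≤ r) (hc₃ : 0 < c₃) (hξ : ξ ≠ 0)
    (hm : m ≤ c₃ * bracket (-r / 2) ξ) : |ξ| * m ≤ c₃ * |ξ| ^ (1 - r / 2) := by
  have hξ' : 0 < |ξ| := abs_pos.2 hξ
  have h1 : bracket (-r / 2) ξ ≤ |ξ| ^ (-(r / 2)) := by
    have h2 := abs_rpow_le_bracket (by linarith : 0 ≤ r / 2) ξ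
    have h3 : bracket (-r / 2) ξ = (bracket (r / 2) ξ)⁻¹ := by
      apply eq_inv_of_mul_eq_one_left
      rw [bracket_mul_bracket,
        show -r / 2 + r / 2 = 0 by ring]
      simp [bracket]
    rw [h3, Real.rpow_neg hξ'.le]
    have := Real.rpow_pos_of_pos hξ' (r / 2)
    gcongr
  calc |ξ| * m ≤ |ξ| * (c₃ * |ξ| ^ (-(r / 2))) := by
        gcongr; exact hm.trans (by gcongr)
    _ = c₃ * (|ξ| ^ (1 : ℝ) * |ξ| ^ (-(r / 2))) := by rw [Real.rpow_one]; ring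
    _ = _ := by rw [← Real.rpow_add hξ']; rfl

theorem rpow_mul_div_le (hr1 : r ≤ 1) (hρr : 1 ≤ ρ / 2 + r) (hc₁ : 0 < c₁)
    (hc₃ : 0 < c₃) (hm0 : 0 < m) (hk0 : 0 < k) (hk : c₁ * bracket (ρ / 2) ξ ≤ k)
    (hm : m ≤ c₃ * bracket (-r / 2) ξ) : |ξ| ^ (1 - r / 2) * (m / k) ≤ c₃ / c₁ := by
  have h1 := div_le_bracket hc₁ hm0 hk hm
  have h2 := abs_rpow_le_bracket (by linarith : 0 ≤ 1 - r / 2) ξ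
  have h4 := bracket_pos (1 - r / 2) ξ
  calc |ξ| ^ (1 - r / 2) * (m / k)
      ≤ bracket (1 - r / 2) ξ * (c₃ / c₁ * bracket (-r / 2 - ρ / 2) ξ) := by gcongr
    _ = c₃ / c₁ * (bracket (1 - r / 2) ξ * bracket (-r / 2 - ρ / 2) ξ) := by ring
    _ ≤ c₃ / c₁ * 1 := by
        gcongr
        rw [bracket_mul_bracket]
        exact bracket_le_one (by linarith) ξ
    _ = _ := mul_one _

end Bounds

/-- The set where the symbols, the weight and their inverses are at most `n`. -/
def goodSet (X k m W : ℝ → ℝ) (n : ℕ) : Set ℝ :=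
  {η | 0 < X η ∧ X η ≤ n ∧ (X η)⁻¹ ≤ n ∧ k η ≤ n ∧ (k η)⁻¹ ≤ n ∧ m η ≤ n ∧ (m η)⁻¹ ≤ n ∧
    (W η)⁻¹ ≤ n}

theorem exhaustion_goodSet {X k m W : ℝ → ℝ} (hX : Measurable X) (hk : Measurable k)
    (hm : Measurable m) (hW : Measurable W) (hX0 : ∀ᵐ η, 0 < X η) :
    Exhaustion (goodSet X k m W) where
  meas n := by
    unfold goodSet
    measurability
  mono i j hij η := by
    have : (i : ℝ) ≤ j := by exact_mod_cast hij
    rintro ⟨h0, h1, h2, h3, h4, h5, h6, h7⟩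
    exact ⟨h0, h1.trans this, h2.trans this, h3.trans this, h4.trans this, h5.trans this,
      h6.trans this, h7.trans this⟩
  ae_mem := by
    filter_upwards [hX0] with η h0
    have h1 : ∀ x : ℝ, ∀ᶠ n : ℕ in atTop, x ≤ n := fun x =>
      tendsto_natCast_atTop_atTop.eventually_ge_atTop x
    exact ((eventually_const.2 h0).and ((h1 _).and ((h1 _).and ((h1 _).and ((h1 _).and
      ((h1 _).and ((h1 _).and (h1 _)))))))).exists

theorem bddOn_of_le {S : ℕ → Set ℝ} {a : ℝ → ℝ} (ha : Measurable a)
    (h : ∀ n, ∀ η ∈ S n, 0 ≤ a η ∧ a η ≤ n) : BddOn S a :=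
  ⟨ha, fun n => ⟨n, fun η hη => by rw [abs_of_nonneg (h n η hη).1]; exact (h n η hη).2⟩⟩

/-- The modulus `|ξ|` of the angular frequency `ξ = 2πη`. -/
def absFreq (η : ℝ) : ℝ := |2 * Real.pi * η|

/-- The square root of the symbol `a` as a function of `η`. -/
def sqrtSymbol (a : ℝ → ℝ) (η : ℝ) : ℝ := Real.sqrt (a (2 * Real.pi * η))

theorem measurable_sqrtSymbol {a : ℝ → ℝ} (ha : Measurable a) : Measurable (sqrtSymbol a) :=
  (ha.comp (by fun_prop)).sqrt

theorem one_add_sq_le (η : ℝ) :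
    1 + (2 * Real.pi * η) ^ 2 ≤ (2 * Real.pi) ^ 2 * (1 + η ^ 2) := by
  nlinarith [Real.pi_gt_three, sq_nonneg η]

/-- The growth conditions on `l` and `b` give the bounds needed for the energy method, with the
regularity exponent `σ = 1 - r/2`. The order `-ν` of the weight compensates the order `2 + ρ` of the
linear term. -/
theorem symbols_goodSet {ρ r c₁ c₂ c₃ ν : ℝ} (hρ : 0 ≤ ρ) (hr : 0 ≤ r) (hr1 : r ≤ 1)
    (hρr : 1 ≤ ρ / 2 + r) (hν : 2 + ρ ≤ ν) (hc₁ : 0 < c₁) (hc₂ : 0 < c₂) (hc₃ : 0 < c₃)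
    {l b : ℝ → ℝ} (hl_meas : Measurable l) (hb_meas : Measurable b)
    (hl : ∀ ξ : ℝ, c₁ ^ 2 * (1 + ξ ^ 2) ^ (ρ / 2) ≤ l ξ ∧ l ξ ≤ c₂ ^ 2 * (1 + ξ ^ 2) ^ (ρ / 2))
    (hb : ∀ ξ : ℝ, 0 < b ξ ∧ b ξ ≤ c₃ ^ 2 * (1 + ξ ^ 2) ^ (-r / 2)) :
    Symbols (goodSet absFreq (sqrtSymbol l) (sqrtSymbol b) (bracket (-ν))) absFreq (sqrtSymbol l)
      (sqrtSymbol b) (bracket (-ν)) (1 - r / 2) (c₃ ^ 2 / c₁) (c₃ * (2 * Real.pi) ^ (1 - r / 2))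
      (c₃ / c₁) := by
  have hX : Measurable absFreq := by unfold absFreq; fun_prop
  have hk := measurable_sqrtSymbol hl_meas
  have hm := measurable_sqrtSymbol hb_meas
  have hW := measurable_bracket (-ν)
  have hl0 : ∀ ξ, 0 < l ξ := fun ξ => lt_of_lt_of_le (by positivity) (hl ξ).1
  have hk0 : ∀ η, 0 < sqrtSymbol l η := fun η => Real.sqrt_pos.2 (hl0 _)
  have hm0 : ∀ η, 0 < sqrtSymbol b η := fun η => Real.sqrt_pos.2 (hb _).1
  have hk' : ∀ η, c₁ * bracket (ρ / 2) (2 * Real.pi * η) ≤ sqrtSymbol l η := by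
    intro η
    apply Real.le_sqrt_of_sq_le
    refine le_trans (le_of_eq ?_) (hl _).1
    rw [mul_pow _ (bracket _ _), sq (bracket _ _), bracket_mul_bracket, bracket]
    congr 2; ring
  have hm' : ∀ η, sqrtSymbol b η ≤ c₃ * bracket (-r / 2) (2 * Real.pi * η) := by
    intro η
    refine Real.sqrt_le_iff.2 ⟨(mul_pos hc₃ (bracket_pos _ _)).le, (hb _).2.trans (le_of_eq ?_)⟩
    rw [mul_pow _ (bracket _ _), sq (bracket _ _), bracket_mul_bracket, bracket]
    congr 2; ring
  have hmk : ∀ η, sqrtSymbol b η / sqrtSymbol l η ≤ c₃ / c₁ := by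
    intro η
    refine (div_le_bracket hc₁ (hm0 η) (hk' η) (hm' η)).trans ?_
    exact mul_le_of_le_one_right (by positivity) (bracket_le_one (by linarith) _)
  have hpi : (1 : ℝ) ≤ 2 * Real.pi := by linarith [Real.pi_gt_three]
  have habs : ∀ η : ℝ, |η| ≤ |2 * Real.pi * η| := fun η => by
    rw [abs_mul, abs_of_pos (by positivity : 0 < 2 * Real.pi)]
    exact le_mul_of_one_le_left (abs_nonneg _) hpi
  refine
    { exh := exhaustion_goodSet hX hk hm hW ?_
      X_pos := fun n η hη => hη.1
      k_pos := hk0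
      m_pos := hm0
      W_pos := bracket_pos _
      X_bdd := bddOn_of_le hX fun n η hη => ⟨hη.1.le, hη.2.1⟩
      X_inv := bddOn_of_le hX.inv fun n η hη => ⟨(inv_pos.2 hη.1).le, hη.2.2.1⟩
      k_bdd := bddOn_of_le hk fun n η hη => ⟨(hk0 η).le, hη.2.2.2.1⟩
      k_inv := bddOn_of_le hk.inv fun n η hη => ⟨(inv_pos.2 (hk0 η)).le, hη.2.2.2.2.1⟩
      m_bdd := bddOn_of_le hm fun n η hη => ⟨(hm0 η).le, hη.2.2.2.2.2.1⟩
      m_inv := bddOn_of_le hm.inv fun n η hη => ⟨(inv_pos.2 (hm0 η)).le, hη.2.2.2.2.2.2.1⟩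
      W_inv := bddOn_of_le hW.inv fun n η hη =>
        ⟨(inv_pos.2 (bracket_pos _ η)).le, hη.2.2.2.2.2.2.2⟩
      W_bdd := bddMeas_bracket (by linarith)
      Wkk_bdd := ⟨by fun_prop, (2 * Real.pi) ^ 2 * (c₂ ^ 2 * ((2 * Real.pi) ^ 2) ^ (ρ / 2)),
        fun η => ?_⟩
      Wmm_bdd := ⟨by fun_prop, (2 * Real.pi) ^ 2 * c₃ ^ 2, fun η => ?_⟩
      mk_bdd := ⟨hm.div hk, c₃ / c₁, fun η => ?_⟩
      σ_pos := by linarith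
      σ_le := by linarith
      C₂_nonneg := by positivity
      le_C₂ := fun n η _ => abs_mul_sq_div_le hρr hc₁ hc₃ (hm0 η) (hk0 η) (hk' η) (hm' η)
      C₃_nonneg := by positivity
      le_C₃ := fun n η hη => ?_
      C₄_nonneg := by positivity
      le_C₄ := fun η => ?_ }
  · have : ∀ᵐ η : ℝ, η ≠ 0 := by simp [ae_iff]
    filter_upwards [this] with η hη
    exact abs_pos.2 (by positivity)
  · have h1 : sqrtSymbol l η ^ 2 = l (2 * Real.pi * η) := Real.sq_sqrt (hl0 _).le
    have h2 : absFreq η ^ 2 = (2 * Real.pi) ^ 2 * η ^ 2 := by unfold absFreq; rw [sq_abs]; ring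
    have h3 := bracket_pos (-ν) η
    have h4 := hl0 (2 * Real.pi * η)
    have h5 := bracket_pos 2 η
    have h6 : η ^ 2 ≤ bracket 2 η := by unfold bracket; norm_num
    simp only [h1, h2]
    rw [abs_of_nonneg (by positivity)]
    calc bracket (-ν) η * ((2 * Real.pi) ^ 2 * η ^ 2) * l (2 * Real.pi * η)
        ≤ bracket (-ν) η * ((2 * Real.pi) ^ 2 * bracket 2 η) *
          (c₂ ^ 2 * (((2 * Real.pi) ^ 2) ^ (ρ / 2) * bracket ρ η)) := by
          gcongr
          · refine (hl _).2.trans ?_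
            unfold bracket
            rw [← Real.mul_rpow (by positivity) (by positivity)]
            gcongr
            exact one_add_sq_le η
      _ = (2 * Real.pi) ^ 2 * (c₂ ^ 2 * ((2 * Real.pi) ^ 2) ^ (ρ / 2)) *
          (bracket (-ν) η * bracket 2 η * bracket ρ η) := by ring
      _ ≤ _ := by
          apply mul_le_of_le_one_right (by positivity)
          rw [bracket_mul_bracket, bracket_mul_bracket]
          exact bracket_le_one (by linarith) η
  · have h1 : sqrtSymbol b η ^ 2 = b (2 * Real.pi * η) := Real.sq_sqrt (hb _).1.le
    have h2 : absFreq η ^ 2 = (2 * Real.pi) ^ 2 * η ^ 2 := by unfold absFreq; rw [sq_abs]; ring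
    have h3 := bracket_pos (-ν) η
    have h4 := (hb (2 * Real.pi * η)).1
    have h5 := bracket_pos 2 η
    have h6 : η ^ 2 ≤ bracket 2 η := by unfold bracket; norm_num
    simp only [h1, h2]
    rw [abs_of_nonneg (by positivity)]
    calc bracket (-ν) η * ((2 * Real.pi) ^ 2 * η ^ 2) * b (2 * Real.pi * η)
        ≤ bracket (-ν) η * ((2 * Real.pi) ^ 2 * bracket 2 η) * (c₃ ^ 2 * 1) := by
          gcongr
          · refine (hb _).2.trans ?_
            gcongr
            exact bracket_le_one (by linarith) _
      _ = (2 * Real.pi) ^ 2 * c₃ ^ 2 * (bracket (-ν) η * bracket 2 η) := by ring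
      _ ≤ _ := by
          apply mul_le_of_le_one_right (by positivity)
          rw [bracket_mul_bracket]
          exact bracket_le_one (by linarith) η
  · rw [abs_of_pos (div_pos (hm0 η) (hk0 η))]
    exact hmk η
  · have h1 : 2 * Real.pi * η ≠ 0 := abs_pos.1 hη.1
    refine (abs_mul_le_rpow hr hc₃ h1 (hm' η)).trans (le_of_eq ?_)
    rw [abs_mul, abs_of_pos (by positivity : 0 < 2 * Real.pi),
      Real.mul_rpow (by positivity) (abs_nonneg _)]
    ring
  · refine le_trans ?_ (rpow_mul_div_le hr1 hρr hc₁ hc₃ (hm0 η) (hk0 η) (hk' η) (hm' η))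
    have := div_pos (hm0 η) (hk0 η)
    have := habs η
    have : 0 ≤ 1 - r / 2 := by linarith
    gcongr

/-! ### From the Cauchy problem to the Fourier side -/

open Classical in
/-- A real function as an element of `L²` (zero if the function is not in `L²`). -/
def toL2 (f : ℝ → ℝ) : L2 :=
  if hf : MemLp (fun x => (f x : ℂ)) 2 volume then hf.toLp _ else 0

theorem ofL2_eq_toL2 (f : ℝ → ℝ) : ofL2 f = ((toL2 f : L2) : 𝓢'(ℝ, ℂ)) := by
  unfold ofL2 toL2
  split_ifs with h
  · rfl
  · exact (map_zero (Lp.toTemperedDistributionCLM ℂ (volume : Measure ℝ) 2)).symm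

theorem toL2_coe {f : ℝ → ℝ} (hf : MemLp (fun x => (f x : ℂ)) 2 volume) :
    toL2 f =ᵐ[volume] fun x => (f x : ℂ) := by
  unfold toL2
  rw [dif_pos hf]
  exact hf.coeFn_toLp

theorem toL2_congr {f f' : ℝ → ℝ} (h : f =ᵐ[volume] f') : toL2 f = toL2 f' := by
  have h' : (fun x => (f x : ℂ)) =ᵐ[volume] fun x => (f' x : ℂ) := by
    filter_upwards [h] with x hx
    rw [hx]
  unfold toL2
  by_cases hf : MemLp (fun x => (f x : ℂ)) 2 volume
  · rw [dif_pos hf, dif_pos ((memLp_congr_ae h').1 hf)]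
    exact MemLp.toLp_congr _ _ h'
  · rw [dif_neg hf, dif_neg fun h => hf ((memLp_congr_ae h').2 h)]

theorem hasDensity_fourier (f : L2) : HasDensity (𝓕 (f : 𝓢'(ℝ, ℂ))) (𝓕 f : L2) := by
  rw [Lp.fourier_toTemperedDistribution_eq]
  exact HasDensity.of_L2 _

theorem fourier_ae_eq_bracket {σ : ℝ} {f w : L2}
    (h : TemperedDistribution.besselPotential ℝ ℂ σ (f : 𝓢'(ℝ, ℂ)) = (w : 𝓢'(ℝ, ℂ))) :
    (𝓕 f : L2) =ᵐ[volume] fun η => (bracket (-σ) η : ℂ) * (𝓕 w : L2) η :=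
  (hasDensity_fourier f).ae_eq (hasDensity_fourier_of_besselPotential h)

theorem continuousOn_fourier {w : ℝ → L2} {I : Set ℝ} (hw : ContinuousOn w I) :
    ContinuousOn (fun t => (𝓕 (w t) : L2)) I :=
  (Lp.fourierTransformₗᵢ ℝ ℂ).continuous.comp_continuousOn hw

theorem hasDerivAt_fourier {w : ℝ → L2} {w' : L2} {t : ℝ} (hw : HasDerivAt w w' t) :
    HasDerivAt (fun t => (𝓕 (w t) : L2)) (𝓕 w') t :=
  ((Lp.fourierTransformₗᵢ ℝ ℂ).toContinuousLinearEquiv.toContinuousLinearMap.restrictScalars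
    ℝ).hasFDerivAt.comp_hasDerivAt t hw

theorem SobolevContinuousOn.continuousOn_fourier {s : ℝ} (hs : 0 ≤ s) {I : Set ℝ}
    {f : ℝ → ℝ → ℝ} (h : SobolevContinuousOn s I fun t => ofL2 (f t)) :
    ContinuousOn (fun t => (𝓕 (toL2 (f t)) : L2)) I := by
  obtain ⟨w, hw, hc⟩ := h
  have h1 : ContinuousOn (fun t => mulOp (bracket (-s)) (𝓕 (w t))) I :=
    (mulOp _).continuous.comp_continuousOn (DoubleDispersive.continuousOn_fourier hc)
  refine h1.congr fun t ht => ?_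
  rw [eq_mulOp_iff (bddMeas_bracket (by linarith))]
  have := hw t ht
  simp only [ofL2_eq_toL2] at this
  exact fourier_ae_eq_bracket this

/-- The embedding of `H^s` into the bounded functions for `s > 1/2`, locally uniformly in time. -/
theorem SobolevContinuousOn.exists_bound {s : ℝ} (hs : 1 / 2 < s) {I J : Set ℝ} (hJ : IsCompact J)
    (hJI : J ⊆ I) {f : ℝ → ℝ → ℝ} (hf : ∀ t ∈ I, MemLp (fun x => (f t x : ℂ)) 2 volume)
    (h : SobolevContinuousOn s I fun t => ofL2 (f t)) :
    ∃ M, 0 ≤ M ∧ ∀ t ∈ J, ∀ᵐ x, |f t x| ≤ M := by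
  obtain ⟨w, hw, hc⟩ := h
  obtain ⟨C, hC⟩ := hJ.exists_bound_of_continuousOn (hc.mono hJI)
  have hi : Integrable fun η : ℝ => bracket (-s) η ^ 2 := by
    have := integrable_rpow_neg_one_add_norm_sq (E := ℝ) (μ := volume) (r := 2 * s)
      (by simp; linarith)
    refine this.congr (ae_of_all _ fun η => ?_)
    simp only [Real.norm_eq_abs, sq_abs]
    rw [sq (bracket _ _), bracket_mul_bracket, bracket]
    congr 1
    ring
  refine ⟨(∫ η, bracket (-s) η ^ 2) + C ^ 2, by positivity, fun t ht => ?_⟩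
  have hwt := hw t (hJI ht)
  simp only [ofL2_eq_toL2] at hwt
  have hae := fourier_ae_eq_bracket hwt
  -- The pointwise bound `ab ≤ a² + b²` takes the place of the Cauchy-Schwarz inequality.
  have hbd : ∀ᵐ η, ‖(𝓕 (toL2 (f t)) : L2) η‖ ≤ bracket (-s) η ^ 2 + ‖(𝓕 (w t) : L2) η‖ ^ 2 := by
    filter_upwards [hae] with η hη
    rw [hη, norm_mul, Complex.norm_real, Real.norm_eq_abs, abs_of_pos (bracket_pos _ _)]
    nlinarith [sq_nonneg (bracket (-s) η - ‖(𝓕 (w t) : L2) η‖), sq_nonneg (bracket (-s) η),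
      sq_nonneg ‖(𝓕 (w t) : L2) η‖]
  have hi2 := hi.add (integrable_norm_sq (𝓕 (w t)))
  have hint : Integrable (𝓕 (toL2 (f t)) : L2) := hi2.mono' (Lp.aestronglyMeasurable _) hbd
  filter_upwards [ae_norm_le_integral_norm_fourier hint, toL2_coe (hf t (hJI ht))] with x h1 h2
  rw [h2, Complex.norm_real, Real.norm_eq_abs] at h1
  refine h1.trans ((integral_mono_ae hint.norm hi2 hbd).trans ?_)
  rw [integral_add' hi (integrable_norm_sq _), ← norm_sq_eq_integral, Lp.norm_fourier_eq]
  gcongr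
  exact hC t ht

theorem exists_lipschitz_extension {g : ℝ → ℝ} (hg : ContDiff ℝ 1 g) (M : ℝ) :
    ∃ (γ : ℝ → ℝ) (K : ℝ≥0), LipschitzWith K γ ∧ EqOn g γ (Icc (-M) M) := by
  obtain ⟨C, hC⟩ := isCompact_Icc.exists_bound_of_continuousOn (s := Icc (-M) M)
    (hg.continuous_deriv le_rfl).continuousOn
  have h1 : LipschitzOnWith C.toNNReal g (Icc (-M) M) := by
    refine (convex_Icc (-M) M).lipschitzOnWith_of_nnnorm_deriv_le
      (fun x _ => (hg.differentiable (by norm_num)).differentiableAt) fun x hx => ?_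
    rw [← NNReal.coe_le_coe, coe_nnnorm]
    exact (hC x hx).trans (Real.le_coe_toNNReal C)
  obtain ⟨γ, hγ, he⟩ := h1.extend_real
  exact ⟨γ, _, hγ, he⟩

theorem primitive_eq_of_eqOn {g γ : ℝ → ℝ} {M y : ℝ} (hM : 0 ≤ M) (h : EqOn g γ (Icc (-M) M))
    (hy : |y| ≤ M) : primitive g y = primitive γ y := by
  apply intervalIntegral.integral_congr
  intro p hp
  apply h
  have h0 : (0 : ℝ) ∈ Icc (-M) M := ⟨by linarith, hM⟩
  exact (ordConnected_Icc.uIcc_subset h0 (abs_le.1 hy)) hp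

section Cauchy

variable {ρ s T : ℝ} {l b g φ : ℝ → ℝ} {ψ : 𝓢'(ℝ, ℂ)} {u : ℝ → ℝ → ℝ} {v : ℝ → 𝓢'(ℝ, ℂ)}

/-- On functions bounded by `M`, the nonlinearity `g` acts as the superposition operator of `γ`. -/
theorem ofL2_comp_eq {γ : ℝ → ℝ} {K : ℝ≥0} (hK : LipschitzWith K γ) (h0 : γ 0 = 0) {M : ℝ}
    (hgγ : EqOn g γ (Icc (-M) M)) {f : ℝ → ℝ} (hf : MemLp (fun x => (f x : ℂ)) 2 volume)
    (hfM : ∀ᵐ x, |f x| ≤ M) :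
    ofL2 (fun x => g (f x)) = (superposition hK h0 (toL2 f) : 𝓢'(ℝ, ℂ)) := by
  have h1 : (fun x => ((g (f x) : ℝ) : ℂ)) =ᵐ[volume] superposition hK h0 (toL2 f) := by
    filter_upwards [superposition_coe hK h0 (toL2 f), toL2_coe hf, hfM] with x e1 e2 e3
    rw [e1, e2, Complex.ofReal_re, hgγ (abs_le.1 e3)]
  have h2 : MemLp (fun x => ((g (f x) : ℝ) : ℂ)) 2 volume := (memLp_congr_ae h1).2 (Lp.memLp _)
  rw [ofL2_eq_toL2]
  congr 1
  exact Lp.ext ((toL2_coe h2).trans h1)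

theorem HasDensity.of_isFourierMultiplier_dxx {a : ℝ → ℝ} {f : L2} {h : 𝓢'(ℝ, ℂ)}
    (hh : IsFourierMultiplier a (dxx (f : 𝓢'(ℝ, ℂ))) h) :
    HasDensity (𝓕 h) fun η => (a (2 * Real.pi * η) : ℂ) *
      (-((2 * Real.pi * η : ℝ) : ℂ) ^ 2 * (𝓕 f : L2) η) := by
  obtain ⟨F, hF, hh⟩ := hh
  refine hh.congr_ae ?_
  filter_upwards [hF.ae_eq (hasDensity_fourier f).fourier_dxx] with η hη
  rw [hη]

/-- The equation tested against Schwartz functions, on the Fourier side. -/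
theorem IsSolution.hasDerivAt_integral {ν : ℝ} (hu : IsSolution ρ s l b g T φ ψ u v)
    (hWl : BddMeas fun η => bracket (-ν) η * absFreq η ^ 2 * sqrtSymbol l η ^ 2)
    (hWb : BddMeas fun η => bracket (-ν) η * absFreq η ^ 2 * sqrtSymbol b η ^ 2)
    (hl : ∀ ξ, 0 ≤ l ξ) (hb : ∀ ξ, 0 ≤ b ξ)
    {Y : ℝ → L2} {V : ℝ → ℝ → ℂ} (hV : ∀ t ∈ Ico 0 T, HasDensity (𝓕 (v t)) (V t))
    (hY : ∀ t ∈ Ico 0 T, Y t =ᵐ[volume] fun η => (bracket (-ν) η : ℂ) * V t η)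
    {t : ℝ} (ht : t ∈ Ioo 0 T) {n : L2}
    (hn : ofL2 (fun x => g (u t x)) = (n : 𝓢'(ℝ, ℂ))) (θ : 𝓢(ℝ, ℂ)) :
    HasDerivAt (fun τ => ∫ x, θ x * Y τ x)
      (∫ x, θ x * (-(mulOp (fun η => bracket (-ν) η * absFreq η ^ 2 * sqrtSymbol l η ^ 2)
        (𝓕 (toL2 (u t)))) - mulOp (fun η => bracket (-ν) η * absFreq η ^ 2 * sqrtSymbol b η ^ 2)
          (𝓕 n) : L2) x) t := by
  obtain ⟨Lu, Bg, hLu, hBg, hd⟩ := hu.equation t ht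
  have hW : Function.HasTemperateGrowth fun η : ℝ => (bracket (-ν) η : ℂ) :=
    hasTemperateGrowth_bracket (-ν)
  -- With this test function, the pairings in the equation become integrals of `θ` on the Fourier
  -- side against `(1 + η²)^(-ν/2)` times the densities.
  set θ' : 𝓢(ℝ, ℂ) := 𝓕 (SchwartzMap.smulLeftCLM ℂ (fun η : ℝ => (bracket (-ν) η : ℂ)) θ) with hθ'
  have key : ∀ {f : 𝓢'(ℝ, ℂ)} {F : ℝ → ℂ}, HasDensity (𝓕 f) F →
      Integrable (fun x => θ x * ((bracket (-ν) x : ℂ) * F x)) ∧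
        f θ' = ∫ x, θ x * ((bracket (-ν) x : ℂ) * F x) := fun hf => hf.smulLeft hW θ
  rw [ofL2_eq_toL2] at hLu
  rw [hn] at hBg
  have e1 := key (HasDensity.of_isFourierMultiplier_dxx hLu)
  have e2 := key (HasDensity.of_isFourierMultiplier_dxx hBg)
  have hd := hd θ'
  rw [e1.2, e2.2, ← integral_add e1.1 e2.1] at hd
  have e3 : (fun τ => v τ θ') =ᶠ[𝓝 t] fun τ => ∫ x, θ x * Y τ x := by
    filter_upwards [Ioo_mem_nhds ht.1 ht.2] with τ hτ
    rw [(key (hV τ (Ioo_subset_Ico_self hτ))).2]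
    apply integral_congr_ae
    filter_upwards [hY τ (Ioo_subset_Ico_self hτ)] with x hx
    rw [hx]
  refine (hd.congr_of_eventuallyEq e3.symm).congr_deriv (integral_congr_ae ?_)
  filter_upwards [Lp.coeFn_sub (-(mulOp (fun η => bracket (-ν) η * absFreq η ^ 2 *
      sqrtSymbol l η ^ 2) (𝓕 (toL2 (u t))))) (mulOp (fun η => bracket (-ν) η * absFreq η ^ 2 *
      sqrtSymbol b η ^ 2) (𝓕 n)), Lp.coeFn_neg (mulOp (fun η => bracket (-ν) η * absFreq η ^ 2 *
      sqrtSymbol l η ^ 2) (𝓕 (toL2 (u t)))), mulOp_coe hWl (𝓕 (toL2 (u t))),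
      mulOp_coe hWb (𝓕 n)] with η h1 h2 h3 h4
  rw [h1, Pi.sub_apply, h2, Pi.neg_apply, h3, h4]
  simp only [sqrtSymbol, absFreq, sq_abs, Real.sq_sqrt (hl _), Real.sq_sqrt (hb _)]
  push_cast
  ring

end Cauchy

/-! ### The amplitudes of the energy -/

section Amplitudes

variable {l b : ℝ → ℝ}

theorem symbolBΛ_eq (hb : ∀ ξ, 0 < b ξ) (η : ℝ) :
    symbolBΛ b (2 * Real.pi * η) = (sqrtSymbol b η)⁻¹ * (absFreq η)⁻¹ := by
  unfold symbolBΛ sqrtSymbol absFreq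
  rw [Real.rpow_neg (hb _).le, Real.sqrt_eq_rpow]

theorem symbolBK_eq (hb : ∀ ξ, 0 < b ξ) (η : ℝ) :
    symbolBK b l (2 * Real.pi * η) = (sqrtSymbol b η)⁻¹ * sqrtSymbol l η := by
  unfold symbolBK sqrtSymbol
  rw [Real.rpow_neg (hb _).le, Real.sqrt_eq_rpow (b _)]

theorem sqrtSymbol_pos {a : ℝ → ℝ} (ha : ∀ ξ, 0 < a ξ) (η : ℝ) : 0 < sqrtSymbol a η :=
  Real.sqrt_pos.2 (ha _)

theorem ae_absFreq_ne_zero : ∀ᵐ η, absFreq η ≠ 0 := by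
  have : ∀ᵐ η : ℝ, η ≠ 0 := by simp [ae_iff]
  filter_upwards [this] with η hη
  unfold absFreq
  positivity

/-- The image of `f` under `B^(-1/2) Λ⁻¹` is `p` if and only if the transform of `f` is `|ξ| b^(1/2)`
times that of `p`. The frequency `0`, where `|ξ|⁻¹` is a junk value, is a null set. -/
theorem isFourierMultiplier_symbolBΛ_iff (hb : ∀ ξ, 0 < b ξ) {f : 𝓢'(ℝ, ℂ)} {V : ℝ → ℂ}
    (hV : HasDensity (𝓕 f) V) (p : L2) :
    IsFourierMultiplier (symbolBΛ b) f (p : 𝓢'(ℝ, ℂ)) ↔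
      ∀ᵐ η, V η = (absFreq η * sqrtSymbol b η : ℝ) * (𝓕 p : L2) η := by
  constructor
  · rintro ⟨F, hF, hp⟩
    filter_upwards [hF.ae_eq hV, hp.ae_eq (hasDensity_fourier p), ae_absFreq_ne_zero]
      with η h1 h2 h3
    rw [← h2, ← h1, symbolBΛ_eq hb, ← mul_assoc, ← Complex.ofReal_mul]
    have := (sqrtSymbol_pos hb η).ne'
    have : absFreq η * sqrtSymbol b η * ((sqrtSymbol b η)⁻¹ * (absFreq η)⁻¹) = 1 := by field_simp
    rw [this, Complex.ofReal_one, one_mul]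
  · intro h
    refine ⟨V, hV, (hasDensity_fourier p).congr_ae ?_⟩
    filter_upwards [h, ae_absFreq_ne_zero] with η h1 h3
    rw [h1, symbolBΛ_eq hb, ← mul_assoc, ← Complex.ofReal_mul]
    have := (sqrtSymbol_pos hb η).ne'
    have : (sqrtSymbol b η)⁻¹ * (absFreq η)⁻¹ * (absFreq η * sqrtSymbol b η) = 1 := by field_simp
    rw [this, Complex.ofReal_one, one_mul]

/-- The image of `f` under `B^(-1/2) K` is `q` if and only if the transform of `f` is
`b^(1/2) / l^(1/2)` times that of `q`. -/
theorem isFourierMultiplier_symbolBK_iff (hb : ∀ ξ, 0 < b ξ) (hl : ∀ ξ, 0 < l ξ) (f q : L2) :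
    IsFourierMultiplier (symbolBK b l) (f : 𝓢'(ℝ, ℂ)) (q : 𝓢'(ℝ, ℂ)) ↔
      ∀ᵐ η, (𝓕 f : L2) η = (sqrtSymbol b η / sqrtSymbol l η : ℝ) * (𝓕 q : L2) η := by
  constructor
  · rintro ⟨F, hF, hp⟩
    filter_upwards [hF.ae_eq (hasDensity_fourier f), hp.ae_eq (hasDensity_fourier q)] with η h1 h2
    rw [← h2, ← h1, symbolBK_eq hb, ← mul_assoc, ← Complex.ofReal_mul]
    have := (sqrtSymbol_pos hb η).ne'
    have := (sqrtSymbol_pos hl η).ne'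
    have : sqrtSymbol b η / sqrtSymbol l η * ((sqrtSymbol b η)⁻¹ * sqrtSymbol l η) = 1 := by
      field_simp
    rw [this, Complex.ofReal_one, one_mul]
  · intro h
    refine ⟨_, hasDensity_fourier f, (hasDensity_fourier q).congr_ae ?_⟩
    filter_upwards [h] with η h1
    rw [h1, symbolBK_eq hb, ← mul_assoc, ← Complex.ofReal_mul]
    have := (sqrtSymbol_pos hb η).ne'
    have := (sqrtSymbol_pos hl η).ne'
    have : (sqrtSymbol b η)⁻¹ * sqrtSymbol l η * (sqrtSymbol b η / sqrtSymbol l η) = 1 := by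
      field_simp
    rw [this, Complex.ofReal_one, one_mul]

end Amplitudes

end DoubleDispersive

end

open DoubleDispersive in
theorem theorem6p2
    (ρ r s c₁ c₂ c₃ : ℝ) (hρ : 0 ≤ ρ) (hr : 0 ≤ r) (hρr : 1 ≤ ρ / 2 + r) (hs : 1 / 2 < s)
    (hc₁ : 0 < c₁) (hc₂ : 0 < c₂) (hc₃ : 0 < c₃)
    (l b : ℝ → ℝ) (hl_meas : Measurable l) (hb_meas : Measurable b)
    (hl : ∀ ξ : ℝ, c₁ ^ 2 * (1 + ξ ^ 2) ^ (ρ / 2) ≤ l ξ ∧ l ξ ≤ c₂ ^ 2 * (1 + ξ ^ 2) ^ (ρ / 2))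
    (hb : ∀ ξ : ℝ, 0 < b ξ ∧ b ξ ≤ c₃ ^ 2 * (1 + ξ ^ 2) ^ (-r / 2))
    (g : ℝ → ℝ) (hg : ContDiff ℝ ((⌊s⌋₊ + 1 : ℕ) : ℕ∞) g) (hg0 : g 0 = 0)
    (T : ℝ) (hT : 0 < T) (φ : ℝ → ℝ) (ψ : 𝓢'(ℝ, ℂ))
    (u : ℝ → ℝ → ℝ) (v : ℝ → 𝓢'(ℝ, ℂ)) (hu : IsSolution ρ s l b g T φ ψ u v)
    (p₀ q₀ : L2)
    (hp₀ : IsFourierMultiplier (symbolBΛ b) ψ (p₀ : 𝓢'(ℝ, ℂ)))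
    (hq₀ : IsFourierMultiplier (symbolBK b l) (ofL2 φ) (q₀ : 𝓢'(ℝ, ℂ)))
    (hG : Integrable (fun x => primitive g (φ x))) :
    ∀ t ∈ Ico 0 T, ∃ p q : L2,
      IsFourierMultiplier (symbolBΛ b) (v t) (p : 𝓢'(ℝ, ℂ)) ∧
      IsFourierMultiplier (symbolBK b l) (ofL2 (u t)) (q : 𝓢'(ℝ, ℂ)) ∧
      Integrable (fun x => primitive g (u t x)) ∧
      ‖p‖ ^ 2 + ‖q‖ ^ 2 + 2 * ∫ x, primitive g (u t x) =
        ‖p₀‖ ^ 2 + ‖q₀‖ ^ 2 + 2 * ∫ x, primitive g (φ x) := by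
  intro t₁ ht₁
  -- Only the exponent `min r 1` of the decay of `b` matters.
  have hb' : ∀ ξ : ℝ, 0 < b ξ ∧ b ξ ≤ c₃ ^ 2 * (1 + ξ ^ 2) ^ (-min r 1 / 2) := fun ξ => by
    refine ⟨(hb ξ).1, (hb ξ).2.trans ?_⟩
    gcongr
    · nlinarith [sq_nonneg ξ]
    · exact min_le_left _ _
  have hb0 : ∀ ξ, 0 < b ξ := fun ξ => (hb ξ).1
  have hl0 : ∀ ξ, 0 < l ξ := fun ξ => lt_of_lt_of_le (by positivity) (hl ξ).1
  set κ : ℝ := s - 1 - ρ / 2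
  -- The weight of order `-ν` brings `u_tt` and the two terms on the right into `L²`, and the order
  -- `-ν - κ` of the multiplier that defines `Y` is nonpositive.
  set ν : ℝ := 2 + ρ + |κ| with hν
  have hρr' : 1 ≤ ρ / 2 + min r 1 := by
    rcases min_choice r 1 with h | h <;> rw [h] <;> linarith
  have hsym := symbols_goodSet hρ (le_min hr zero_le_one) (min_le_right r 1) hρr'
    (show 2 + ρ ≤ ν by linarith [abs_nonneg κ]) hc₁ hc₂ hc₃ hl_meas hb_meas hl hb'
  have hsub : Icc 0 t₁ ⊆ Ico 0 T := fun τ hτ => ⟨hτ.1, hτ.2.trans_lt ht₁.2⟩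
  -- On `[0, t₁]` the solution is bounded, so that `g` may be replaced by a Lipschitz function.
  obtain ⟨M, hM0, hM⟩ := hu.continuousOn.exists_bound hs isCompact_Icc hsub hu.memLp
  have hg1 : ContDiff ℝ 1 g := hg.of_le (by exact_mod_cast Nat.le_add_left 1 ⌊s⌋₊)
  obtain ⟨γ, K, hK, hgγ⟩ := exists_lipschitz_extension hg1 M
  have h0 : γ 0 = 0 := by rw [← hgγ ⟨by linarith, hM0⟩, hg0]
  obtain ⟨w, w', hw, hw', hderiv, hc⟩ := hu.c1On
  set V : ℝ → ℝ → ℂ := fun t η => (bracket (-κ) η : ℂ) * (𝓕 (w' t) : L2) η with hVdef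
  set U : ℝ → L2 := fun t => 𝓕 (toL2 (u t)) with hUdef
  set Y : ℝ → L2 := fun t => mulOp (bracket (-ν - κ)) (𝓕 (w' t)) with hYdef
  have hνκ : -ν - κ ≤ 0 := by linarith [neg_abs_le κ]
  have hV : ∀ t ∈ Ico 0 T, HasDensity (𝓕 (v t)) (V t) := fun t ht =>
    hasDensity_fourier_of_besselPotential (hw' t ht)
  have hYV : ∀ t, Y t =ᵐ[volume] fun η => (bracket (-ν) η : ℂ) * V t η := by
    intro t
    filter_upwards [mulOp_coe (bddMeas_bracket hνκ) (𝓕 (w' t))] with η hη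
    simp only [hYdef, hVdef]
    rw [hη, ← mul_assoc, ← Complex.ofReal_mul, bracket_mul_bracket, ← sub_eq_add_neg]
  have hUcont : ContinuousOn U (Ico 0 T) := hu.continuousOn.continuousOn_fourier (by linarith)
  have hφ : toL2 φ = toL2 (u 0) := (toL2_congr hu.initial).symm
  have h0T : (0 : ℝ) ∈ Ico 0 T := ⟨le_rfl, hT⟩
  -- The amplitude of `Y` is the one of the density `V` of the transform of `u_t`.
  have hamp : ∀ t, ∀ P : L2, (∀ᵐ η, Y t η =
      (bracket (-ν) η * absFreq η * sqrtSymbol b η : ℝ) * P η) ↔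
      ∀ᵐ η, V t η = (absFreq η * sqrtSymbol b η : ℝ) * P η := by
    intro t P
    apply Filter.eventually_congr
    filter_upwards [hYV t] with η hη
    have hne : (bracket (-ν) η : ℂ) ≠ 0 := by exact_mod_cast (bracket_pos (-ν) η).ne'
    rw [hη, mul_assoc, Complex.ofReal_mul, mul_assoc]
    exact mul_right_inj' hne
  have he : Evolution absFreq (sqrtSymbol l) (sqrtSymbol b) (bracket (-ν)) hK h0 t₁ U Y
      (𝓕 p₀) (𝓕 q₀) := by
    refine
      { T_nonneg := ht₁.1
        U_cont := hUcont.mono hsub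
        Y_cont := (mulOp _).continuous.comp_continuousOn (continuousOn_fourier (hc.mono hsub))
        U_deriv := fun t ht => ?_
        Y_deriv := fun t ht => ?_
        P₀_eq := ?_
        Q₀_eq := ?_ }
    · have htT : t ∈ Ioo 0 T := ⟨ht.1, ht.2.trans ht₁.2⟩
      have h1 := (hderiv t (Ioo_subset_Ico_self htT)).hasDerivAt (Ico_mem_nhds htT.1 htT.2)
      have h2 := (mulOp (bracket (-ν - κ))).hasFDerivAt.comp_hasDerivAt t (hasDerivAt_fourier h1)
      refine h2.congr_of_eventuallyEq ?_
      filter_upwards [Ioo_mem_nhds htT.1 htT.2] with τ hτ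
      have h3 := hw τ (Ioo_subset_Ico_self hτ)
      simp only [ofL2_eq_toL2] at h3
      apply mulOp_congr hsym.W_bdd (bddMeas_bracket hνκ)
      filter_upwards [fourier_ae_eq_bracket h3] with η hη
      rw [hη, ← mul_assoc, ← Complex.ofReal_mul, bracket_mul_bracket, ← sub_eq_add_neg]
    · have hN : ContinuousOn (fun t => fourierSuperposition hK h0 (U t)) (Ioo 0 t₁) :=
        (continuous_fourierSuperposition hK h0).comp_continuousOn
          (hUcont.mono (Ioo_subset_Icc_self.trans hsub))
      refine hasDerivAt_of_pairing (Z := fun t =>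
        -(mulOp (fun η => bracket (-ν) η * absFreq η ^ 2 * sqrtSymbol l η ^ 2) (U t)) -
          mulOp (fun η => bracket (-ν) η * absFreq η ^ 2 * sqrtSymbol b η ^ 2)
            (fourierSuperposition hK h0 (U t))) isOpen_Ioo ?_ (fun θ t ht => ?_) ht
      · exact ((mulOp _).continuous.comp_continuousOn
          (hUcont.mono (Ioo_subset_Icc_self.trans hsub))).neg.sub
          ((mulOp _).continuous.comp_continuousOn hN)
      · have htI := hsub (Ioo_subset_Icc_self ht)
        have hn := ofL2_comp_eq hK h0 hgγ (hu.memLp t htI) (hM t (Ioo_subset_Icc_self ht))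
        have := hu.hasDerivAt_integral hsym.Wkk_bdd hsym.Wmm_bdd (fun ξ => (hl0 ξ).le)
          (fun ξ => (hb0 ξ).le) hV (fun t _ => hYV t) ⟨ht.1, htI.2⟩ hn θ
        simpa only [fourierSuperposition, hUdef, FourierTransform.fourierInv_fourier_eq] using this
    · rw [hamp]
      rw [← hu.initial_deriv] at hp₀
      exact (isFourierMultiplier_symbolBΛ_iff hb0 (hV 0 h0T) p₀).1 hp₀
    · rw [ofL2_eq_toL2, hφ] at hq₀
      exact (isFourierMultiplier_symbolBK_iff hb0 hl0 _ q₀).1 hq₀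
  obtain ⟨P, Q, hP, hQ, hE⟩ := he.energy_eq hsym
  -- The potential energy of the Lipschitz function is the one of `g`.
  have hpot : ∀ t ∈ Icc 0 t₁, (fun x => primitive g (u t x)) =ᵐ[volume]
      fun x => primitive γ ((𝓕⁻ (U t) : L2) x).re := by
    intro t ht
    filter_upwards [toL2_coe (hu.memLp t (hsub ht)), hM t ht] with x h1 h2
    simp only [hUdef, FourierTransform.fourierInv_fourier_eq]
    rw [h1, Complex.ofReal_re]
    exact primitive_eq_of_eqOn hM0 hgγ h2
  have hpot0 : (fun x => primitive g (φ x)) =ᵐ[volume]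
      fun x => primitive γ ((𝓕⁻ (U 0) : L2) x).re := by
    filter_upwards [hpot 0 (left_mem_Icc.2 ht₁.1), hu.initial] with x h1 h2
    rw [← h1, h2]
  refine ⟨𝓕⁻ P, 𝓕⁻ Q, ?_, ?_, ?_, ?_⟩
  · rw [isFourierMultiplier_symbolBΛ_iff hb0 (hV t₁ ht₁), FourierTransform.fourier_fourierInv_eq]
    exact (hamp t₁ P).1 hP
  · rw [ofL2_eq_toL2, isFourierMultiplier_symbolBK_iff hb0 hl0,
      FourierTransform.fourier_fourierInv_eq]
    exact hQ
  · exact (integrable_primitive_re hK h0 _).congr (hpot t₁ (right_mem_Icc.2 ht₁.1)).symm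
  · rw [integral_congr_ae (hpot t₁ (right_mem_Icc.2 ht₁.1)), integral_congr_ae hpot0,
      norm_fourierInv_eq, norm_fourierInv_eq]
    rw [Lp.norm_fourier_eq, Lp.norm_fourier_eq] at hE
    exact hE
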